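/- Let $k$ be a commutative ring (for example $k=\mathbb{Z}$ or a prime field) and let $n\in\mathbb{N}$. For a category $\mathcal{C}$ with a zero object and finite coproducts (written $+$), a functor $F:\mathcal{C}\to k\text{-}\mathbf{Mod}$ has cross effects $$cr_m(F)(X_1,\dots,X_m)=\ker\Big(F(X_1+\cdots+X_m)\to\bigoplus_{i=1}^m F(X_1+\cdots+\widehat{X_i}+\cdots+X_m)\Big).$$ Let $\mathbf{Pol}_{n}(\mathcal{C})$ be the category of polynomial functors of degree at most $n$, i.e. the full subcategory of the functors $\mathcal{C}\to k\text{-}\mathbf{Mod}$ with $cr_{n+1}(F)=0$, where $\mathbf{Pol}_{-1}(\mathcal{C})$ consists of the zero functors. Let $\mathbf{Pol}_n(\mathcal{C})/\mathbf{Pol}_{n-1}(\mathcal{C})$ be the quotient category, i.e. the localization of $\mathbf{Pol}_n(\mathcal{C})$ at the morphisms whose kernel and cokernel lie in $\mathbf{Pol}_{n-1}(\mathcal{C})$. For an object $E$ of $\mathcal{C}$, let $\langle E\rangle_{\mathcal{C}}$ be the full subcategory of finite sums of copies of $E$, and let $\Lambda_{\mathcal{C}}(E)$ be the $k$-algebra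 quotient of $k[\mathrm{End}_{\mathcal{C}}(E)]$ by the two-sided ideal which is the image of $p_{1*}+p_{2*}-s_*:k[\mathcal{C}(E,E+E)]\to k[\mathcal{C}(E,E)]$, where $p_1,p_2,s:E+E\to E$ are the two projections and the sum. (1) Let $\Phi:\mathcal{C}\to\mathcal{D}$ be a full functor, commuting with finite coproducts, between categories with a zero object and finite coproducts, let $E$ be an object of $\mathcal{C}$, and suppose that $\mathcal{C}(E,E)\to\mathcal{D}(\Phi(E),\Phi(E))$ is bijective. Then $\Phi$ induces an isomorphism of $k$-algebras $\Lambda_{\mathcal{C}}(E)\simeq\Lambda_{\mathcal{D}}(\Phi(E))$, and precomposition with $\Phi:\langle E\rangle_{\mathcal{C}}\to\langle\Phi(E)\rangle_{\mathcal{D}}$ induces an equivalence of categories $$\mathbf{Pol}_n(\langle \Phi(E)\rangle_{\mathcal{D}})/\mathbf{Pol}_{n-1}(\langle \Phi(E)\rangle_{\mathcal{D}})\simeq\mathbf{Pol}_n(\langle E\rangle_{\mathcal{C}})/\mathbf{Pol}_{n-1}(\langle E\rangle_{\mathcal{C}}).$$ (2) Let $\mathbf{gr}$ be the category of finitely generated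 free groups and $\mathbf{ab}$ that of free abelian groups of finite rank. Precomposition with the abelianization functor $\mathbf{gr}\to\mathbf{ab}$ and the functor $F\mapsto cr_n(F)(\mathbb{Z},\dots,\mathbb{Z})$, on which the symmetric group $\mathfrak{S}_n$ acts by permuting the summands of $\mathbb{Z}^{n}$, induce equivalences of categories $$\mathbf{Pol}_n(\mathbf{gr})/\mathbf{Pol}_{n-1}(\mathbf{gr})\simeq\mathbf{Pol}_n(\mathbf{ab})/\mathbf{Pol}_{n-1}(\mathbf{ab})\simeq k[\mathfrak{S}_n]\text{-}\mathbf{Mod}.$$ -/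

import Mathlib

open CategoryTheory CategoryTheory.Limits

universe w v v' u u' t

namespace PolyFun

noncomputable section

/-! ### Cross effects and polynomial functors -/

section CrossEffects

variable {C : Type u} [Category.{v} C] [HasFiniteCoproducts C]

/-- The symmetric group acts on `E + ⋯ + E` by permuting the summands. -/
def permMap (E : C) {n : ℕ} (σ : Equiv.Perm (Fin n)) :
    (∐ fun _ : Fin n => E) ⟶ ∐ fun _ : Fin n => E :=
  Sigma.desc fun j => Sigma.ι (fun _ : Fin n => E) (σ j)

lemma permMap_one (E : C) {n : ℕ} : permMap E (1 : Equiv.Perm (Fin n)) = 𝟙 _ := by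
  refine Sigma.hom_ext _ _ fun j => ?_
  simp [permMap]

lemma permMap_mul (E : C) {n : ℕ} (σ τ : Equiv.Perm (Fin n)) :
    permMap E (σ * τ) = permMap E τ ≫ permMap E σ := by
  refine Sigma.hom_ext _ _ fun j => ?_
  simp [permMap]

variable [HasZeroMorphisms C] {k : Type t} [CommRing k]

/-- The canonical map `X₁ + ⋯ + Xₙ ⟶ X₁ + ⋯ + X̂ᵢ + ⋯ + Xₙ` which forgets the `i`-th summand. -/
def deletion {n : ℕ} (X : Fin n → C) (i : Fin n) :
    (∐ X) ⟶ ∐ (fun j : {j : Fin n // j ≠ i} => X j) :=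
  Sigma.desc fun j =>
    if h : j = i then 0 else Sigma.ι (fun j : {j : Fin n // j ≠ i} => X j) ⟨j, h⟩

/-- The value `cr_n(F)(X₁, …, Xₙ)` of the `n`-th cross effect: the kernel of
`F(X₁ + ⋯ + Xₙ) ⟶ ⨁ᵢ F(X₁ + ⋯ + X̂ᵢ + ⋯ + Xₙ)`. -/
def crossEffect (F : C ⥤ ModuleCat.{w} k) {n : ℕ} (X : Fin n → C) :
    Submodule k (F.obj (∐ X)) :=
  ⨅ i : Fin n, LinearMap.ker (F.map (deletion X i)).hom

variable (C k) in
/-- `DegreeLT C k n` is the class of polynomial functors of degree at most `n - 1`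
from `C` to `k`-modules, i.e. `Pol_{n-1}(C)`: those with `cr_n = 0` if `n ≥ 1`,
and only the zero functors if `n = 0`. -/
def DegreeLT : ℕ → ObjectProperty (C ⥤ ModuleCat.{w} k)
  | 0 => fun F => IsZero F
  | n + 1 => fun F => ∀ X : Fin (n + 1) → C, crossEffect F X = ⊥

variable (C k) in
/-- The category `Pol_n(C)` of polynomial functors of degree at most `n`,
a full subcategory of the category of all functors from `C` to `k`-modules. (It is closed under
kernels and cokernels, which may therefore be computed in the category of all functors.) -/
abbrev Pol (n : ℕ) := (DegreeLT.{w} C k (n + 1)).FullSubcategory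

variable (C k) in
/-- The morphisms of `Pol_n(C)` whose kernel and cokernel belong to `Pol_{n-1}(C)`. -/
def polIso (n : ℕ) : MorphismProperty (Pol.{w} C k n) := fun _ _ f =>
  DegreeLT.{w} C k n (kernel f.hom) ∧ DegreeLT.{w} C k n (cokernel f.hom)

variable (C k) in
/-- The quotient category `Pol_n(C) / Pol_{n-1}(C)` in the sense of Gabriel and Serre: the
localization of `Pol_n(C)` at the morphisms with kernel and cokernel in `Pol_{n-1}(C)`. -/
abbrev PolQuot (n : ℕ) := (polIso.{w} C k n).Localization

variable (C k) in
/-- The projection `Pol_n(C) ⥤ Pol_n(C) / Pol_{n-1}(C)`. -/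
abbrev polProj (n : ℕ) : Pol.{w} C k n ⥤ PolQuot.{w} C k n := (polIso.{w} C k n).Q

/-- The functor `Φ : C ⥤ D` induces, by precomposition, a functor `Pol_n(D) ⥤ Pol_n(C)`,
and this functor induces an equivalence
`Pol_n(D) / Pol_{n-1}(D) ≌ Pol_n(C) / Pol_{n-1}(C)` between the quotient categories. -/
def InducesPolQuotEquivalence {D : Type u'} [Category.{v'} D] [HasZeroMorphisms D]
    [HasFiniteCoproducts D] (k : Type t) [CommRing k] (Φ : C ⥤ D) (n : ℕ) : Prop :=
  ∃ h : ∀ G : D ⥤ ModuleCat.{w} k,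
      DegreeLT.{w} D k (n + 1) G → DegreeLT.{w} C k (n + 1) (Φ ⋙ G),
    ∃ e : PolQuot.{w} D k n ≌ PolQuot.{w} C k n,
      Nonempty (polProj.{w} D k n ⋙ e.functor ≅
        (DegreeLT.{w} C k (n + 1)).lift
          ((DegreeLT.{w} D k (n + 1)).ι ⋙ (Functor.whiskeringLeft C D (ModuleCat.{w} k)).obj Φ)
          (fun G => h G.obj G.property) ⋙ polProj.{w} C k n)

/-! The functor `F ↦ cr_n(F)(E, …, E)` with values in `k[𝔖ₙ]`-modules. -/

lemma permMap_deletion (E : C) {n : ℕ} (σ : Equiv.Perm (Fin n)) (i : Fin n) :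
    ∃ φ, permMap E σ ≫ deletion (fun _ : Fin n => E) (σ i) =
      deletion (fun _ : Fin n => E) i ≫ φ := by
  refine ⟨Sigma.desc fun j => Sigma.ι (fun _ : {j : Fin n // j ≠ σ i} => E)
    ⟨σ j.1, fun h => j.2 (σ.injective h)⟩, Sigma.hom_ext _ _ fun j => ?_⟩
  by_cases h : j = i
  · subst h; simp [permMap, deletion]
  · simp [permMap, deletion, h]

lemma map_permMap_mem (F : C ⥤ ModuleCat.{w} k) (E : C) {n : ℕ} (σ : Equiv.Perm (Fin n))
    (x : F.obj (∐ fun _ : Fin n => E)) (hx : x ∈ crossEffect F fun _ : Fin n => E) :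
    (F.map (permMap E σ)).hom x ∈ crossEffect F fun _ : Fin n => E := by
  simp only [crossEffect, Submodule.mem_iInf, LinearMap.mem_ker] at hx ⊢
  intro i
  obtain ⟨i, rfl⟩ := σ.surjective i
  obtain ⟨φ, hφ⟩ := permMap_deletion E σ i
  rw [← LinearMap.comp_apply, ← ModuleCat.hom_comp, ← F.map_comp, hφ, F.map_comp,
    ModuleCat.hom_comp, LinearMap.comp_apply, hx i, map_zero]

/-- The action of the symmetric group on `cr_n(F)(E, …, E)`. -/
def crossEffectRep (F : C ⥤ ModuleCat.{w} k) (E : C) (n : ℕ) :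
    Representation k (Equiv.Perm (Fin n)) (crossEffect F fun _ : Fin n => E) where
  toFun σ := (F.map (permMap E σ)).hom.restrict (map_permMap_mem F E σ)
  map_one' := by
    ext x
    simp [LinearMap.restrict_apply, permMap_one]
  map_mul' σ τ := by
    ext x
    simp [LinearMap.restrict_apply, permMap_mul]

lemma app_mem {F G : C ⥤ ModuleCat.{w} k} (α : F ⟶ G) {n : ℕ} (X : Fin n → C)
    (x : F.obj (∐ X)) (hx : x ∈ crossEffect F X) :
    (α.app (∐ X)).hom x ∈ crossEffect G X := by
  simp only [crossEffect, Submodule.mem_iInf, LinearMap.mem_ker] at hx ⊢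
  intro i
  rw [← LinearMap.comp_apply, ← ModuleCat.hom_comp, ← α.naturality,
    ModuleCat.hom_comp, LinearMap.comp_apply, hx i, map_zero]

/-- The functor `F ↦ cr_n(F)(E, …, E)` to representations of the symmetric group. -/
def crossEffectRepFunctor (k : Type t) [CommRing k] (E : C) (n : ℕ) :
    (C ⥤ ModuleCat.{w} k) ⥤ Rep.{w} k (Equiv.Perm (Fin n)) where
  obj F := Rep.of (crossEffectRep F E n)
  map {F G} α := Rep.ofHom
    { (α.app (∐ fun _ : Fin n => E)).hom.restrict (app_mem α fun _ : Fin n => E) with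
      isIntertwining' := fun σ => by
        ext x
        simp [LinearMap.restrict_apply, crossEffectRep] }
  map_id F := by
    ext x
    rfl
  map_comp α β := by
    ext x
    rfl

/-- The functor `F ↦ cr_n(F)(E, …, E)` from functors to `k[𝔖ₙ]`-modules. -/
def crossEffectFunctor (k : Type t) [CommRing k] (E : C) (n : ℕ) :
    (C ⥤ ModuleCat.{w} k) ⥤ ModuleCat.{w} (MonoidAlgebra k (Equiv.Perm (Fin n))) :=
  crossEffectRepFunctor k E n ⋙ Rep.equivalenceModuleMonoidAlgebra.functor

end CrossEffects

/-! ### The subcategory generated by an object, and the algebra `Λ` -/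

section Span

variable {C : Type u} [Category.{v} C] [HasFiniteCoproducts C]

/-- The objects of `C` which are finite coproducts of copies of `E`. -/
def finiteSums (E : C) : ObjectProperty C := fun X =>
  ∃ n : ℕ, Nonempty (X ≅ ∐ fun _ : Fin n => E)

/-- The full subcategory `⟨E⟩_C` of finite coproducts of copies of `E`. -/
abbrev Span (E : C) := (finiteSums E).FullSubcategory

instance (E : C) : (finiteSums E).IsClosedUnderIsomorphisms where
  of_iso e h := h.imp fun _ ⟨f⟩ => ⟨e.symm ≪≫ f⟩

instance (E : C) (m : ℕ) : (finiteSums E).IsClosedUnderColimitsOfShape (Discrete (Fin m)) where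
  colimitsOfShape_le X := by
    rintro ⟨c, hc⟩
    choose a ha using fun i : Fin m => hc ⟨i⟩
    let e (i : Fin m) : c.diag.obj ⟨i⟩ ≅ ∐ fun _ : Fin (a i) => E := (ha i).some
    refine ⟨∑ i, a i, ⟨?_⟩⟩
    exact c.isColimit.coconePointUniqueUpToIso (colimit.isColimit c.diag) ≪≫
      HasColimit.isoOfNatIso (Discrete.natIsoFunctor) ≪≫
      Sigma.mapIso (f := c.diag.obj ∘ Discrete.mk)
        (g := fun i => ∐ fun _ : Fin (a i) => E) e ≪≫
      sigmaSigmaIso (fun i => Fin (a i)) (fun _ _ => E) ≪≫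
      Sigma.whiskerEquiv (f := fun _ => E) (g := fun _ => E) finSigmaFinEquiv
        (fun _ => Iso.refl E)

instance (E : C) : HasFiniteCoproducts (Span E) where
  out _ := inferInstance

/-- The functor `⟨E⟩_C ⥤ ⟨Φ(E)⟩_D` obtained by restriction from a functor `Φ : C ⥤ D` which
commutes with finite coproducts. -/
def spanFunctor {D : Type u'} [Category.{v'} D] [HasFiniteCoproducts D] (Φ : C ⥤ D)
    [PreservesFiniteCoproducts Φ] (E : C) : Span E ⥤ Span (Φ.obj E) :=
  (finiteSums (Φ.obj E)).lift ((finiteSums E).ι ⋙ Φ) fun X =>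
    X.property.imp fun _ ⟨f⟩ => ⟨Φ.mapIso f ≪≫ PreservesCoproduct.iso Φ _⟩

variable [HasZeroMorphisms C] (k : Type t) [CommRing k]

/-- The map `P_E(p₁) + P_E(p₂) - P_E(s) : k[C(E, E + E)] ⟶ k[C(E, E)]`, where `p₁`, `p₂` and `s`
are the two projections and the sum `E + E ⟶ E`. -/
def lambdaRel (E : C) : ((E ⟶ E ⨿ E) →₀ k) →ₗ[k] MonoidAlgebra k (End E) :=
  Finsupp.linearCombination k fun f : E ⟶ E ⨿ E =>
    MonoidAlgebra.of k (End E) (f ≫ coprod.desc (𝟙 E) 0)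
      + MonoidAlgebra.of k (End E) (f ≫ coprod.desc 0 (𝟙 E))
      - MonoidAlgebra.of k (End E) (f ≫ coprod.desc (𝟙 E) (𝟙 E))

lemma of_mul_lambdaRel (E : C) (g : End E) (y : (E ⟶ E ⨿ E) →₀ k) :
    MonoidAlgebra.of k (End E) g * lambdaRel k E y ∈ LinearMap.range (lambdaRel k E) := by
  induction y using Finsupp.induction_linear with
  | zero => simp
  | add a b ha hb => rw [map_add, mul_add]; exact add_mem ha hb
  | single f r =>
    refine ⟨Finsupp.single (f ≫ coprod.map g g) r, ?_⟩
    simp only [lambdaRel, Finsupp.linearCombination_single, mul_smul_comm, mul_add, mul_sub,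
      ← map_mul, End.mul_def, Category.assoc]
    simp

lemma lambdaRel_mul_of (E : C) (g : End E) (y : (E ⟶ E ⨿ E) →₀ k) :
    lambdaRel k E y * MonoidAlgebra.of k (End E) g ∈ LinearMap.range (lambdaRel k E) := by
  induction y using Finsupp.induction_linear with
  | zero => simp
  | add a b ha hb => rw [map_add, add_mul]; exact add_mem ha hb
  | single f r =>
    refine ⟨Finsupp.single ((show E ⟶ E from g) ≫ f) r, ?_⟩
    simp only [lambdaRel, Finsupp.linearCombination_single, smul_mul_assoc, add_mul, sub_mul,
      ← map_mul, End.mul_def, Category.assoc]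

/-- The image of `lambdaRel` is a two-sided ideal of `k[End(E)]`. -/
def lambdaIdeal (E : C) : Ideal (MonoidAlgebra k (End E)) where
  carrier := LinearMap.range (lambdaRel k E)
  add_mem' := add_mem
  zero_mem' := zero_mem (LinearMap.range (lambdaRel k E))
  smul_mem' a x hx := by
    obtain ⟨y, rfl⟩ := hx
    change a * _ ∈ LinearMap.range (lambdaRel k E)
    induction a using MonoidAlgebra.induction_on with
    | of g => exact of_mul_lambdaRel k E g y
    | add a b ha hb => rw [add_mul]; exact add_mem ha hb
    | smul r a ha => rw [smul_mul_assoc]; exact Submodule.smul_mem _ r ha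

instance (E : C) : (lambdaIdeal k E).IsTwoSided where
  mul_mem_of_left {x} a hx := by
    obtain ⟨y, rfl⟩ := hx
    change _ * a ∈ LinearMap.range (lambdaRel k E)
    induction a using MonoidAlgebra.induction_on with
    | of g => exact lambdaRel_mul_of k E g y
    | add a b ha hb => rw [mul_add]; exact add_mem ha hb
    | smul r a ha => rw [mul_smul_comm]; exact Submodule.smul_mem _ r ha

/-- The `k`-algebra `Λ_C(E)`, the cokernel of `k[C(E, E + E)] ⟶ k[End(E)]`. -/
abbrev Lambda (E : C) := MonoidAlgebra k (End E) ⧸ lambdaIdeal k E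

/-- The class in `Λ_C(E)` of an endomorphism of `E`. -/
def Lambda.mk (E : C) (f : E ⟶ E) : Lambda k E :=
  Ideal.Quotient.mk (lambdaIdeal k E) (MonoidAlgebra.of k (End E) f)

end Span

/-! ### Free groups and free abelian groups of finite rank -/

/-- Finitely generated free groups. -/
def isFreeFG : ObjectProperty GrpCat.{0} := fun G => IsFreeGroup G ∧ Group.FG G

/-- The category `gr` of finitely generated free groups. -/
abbrev Gr := isFreeFG.FullSubcategory

/-- Free abelian groups of finite rank. -/
def isFreeAbFG : ObjectProperty AddCommGrpCat.{0} := fun A => Module.Free ℤ A ∧ Module.Finite ℤ A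

/-- The category `ab` of free abelian groups of finite rank. -/
abbrev Ab := isFreeAbFG.FullSubcategory

/-- The group `ℤ` as an object of `ab`. -/
def Ab.int : Ab := ⟨AddCommGrpCat.of ℤ, inferInstanceAs (Module.Free ℤ ℤ),
  inferInstanceAs (Module.Finite ℤ ℤ)⟩

instance : HasZeroMorphisms GrpCat.{0} where
  zero G H := ⟨GrpCat.ofHom 1⟩
  comp_zero f _ := by ext; rfl
  zero_comp _ _ _ f := by ext; exact map_one f.hom

/-- The free product of a family of groups, as a cofan. -/
def freeProduct {m : ℕ} (X : Fin m → GrpCat.{0}) : Cofan X :=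
  Cofan.mk (GrpCat.of (Monoid.CoprodI fun i => (X i : Type))) fun i =>
    GrpCat.ofHom (Monoid.CoprodI.of (M := fun i => (X i : Type)) (i := i))

/-- The free product is the coproduct of groups. -/
def freeProductIsColimit {m : ℕ} (X : Fin m → GrpCat.{0}) : IsColimit (freeProduct X) :=
  Cofan.IsColimit.mk _
    (fun s => GrpCat.ofHom
      (Monoid.CoprodI.lift (M := fun i => (X i : Type)) fun i => (s.inj i).hom))
    (fun s i => by
      ext x
      exact Monoid.CoprodI.lift_of (M := fun i => (X i : Type)) (fun i => (s.inj i).hom) x)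
    (fun s f hf => by
      apply GrpCat.hom_ext
      apply Monoid.CoprodI.ext_hom
      intro i
      ext x
      have := congrArg (fun g => g.hom x) (hf i)
      exact this.trans (Monoid.CoprodI.lift_of (M := fun i => (X i : Type))
        (fun i => (s.inj i).hom) x).symm)

lemma group_fg_coprodI {m : ℕ} (G : Fin m → Type) [∀ i, Group (G i)] [∀ i, Group.FG (G i)] :
    Group.FG (Monoid.CoprodI G) := by
  choose S hS hfin using fun i => Group.fg_iff.1 (‹∀ i, Group.FG (G i)› i)
  refine Group.fg_iff.2 ⟨⋃ i, Monoid.CoprodI.of (M := G) (i := i) '' S i, ?_,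
    Set.finite_iUnion fun i => (hfin i).image _⟩
  have hid : Monoid.CoprodI.lift (fun i => Monoid.CoprodI.of (M := G) (i := i)) =
      MonoidHom.id (Monoid.CoprodI G) := Monoid.CoprodI.ext_hom _ _ fun i => by ext x; simp
  have htop := Monoid.CoprodI.range_eq_iSup G (fun i => Monoid.CoprodI.of (M := G) (i := i))
  rw [hid, MonoidHom.range_eq_top.2 Function.surjective_id] at htop
  rw [Subgroup.closure_iUnion, eq_top_iff, htop]
  refine iSup_mono fun i => ?_
  rw [← MonoidHom.map_closure, hS, MonoidHom.range_eq_map]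

lemma isFreeFG_of_mulEquiv {G H : GrpCat.{0}} (e : G ≃* H) (h : isFreeFG G) : isFreeFG H :=
  have := h.1
  have := h.2
  ⟨IsFreeGroup.ofMulEquiv e, Group.fg_of_surjective (f := e.toMonoidHom) e.surjective⟩

instance (m : ℕ) : isFreeFG.IsClosedUnderColimitsOfShape (Discrete (Fin m)) where
  colimitsOfShape_le X := by
    rintro ⟨c, hc⟩
    have h1 (i : Fin m) : IsFreeGroup (c.diag.obj ⟨i⟩) := (hc ⟨i⟩).1
    have h2 (i : Fin m) : Group.FG (c.diag.obj ⟨i⟩) := (hc ⟨i⟩).2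
    let Y : Fin m → GrpCat.{0} := fun i => c.diag.obj ⟨i⟩
    have h : isFreeFG (freeProduct Y).pt :=
      ⟨inferInstanceAs (IsFreeGroup (Monoid.CoprodI fun i => (Y i : Type))),
        group_fg_coprodI fun i => (Y i : Type)⟩
    let e : (freeProduct Y).pt ≅ X :=
      (freeProductIsColimit Y).coconePointsIsoOfNatIso c.isColimit Discrete.natIsoFunctor.symm
    exact isFreeFG_of_mulEquiv e.groupIsoToMulEquiv h

instance : HasFiniteCoproducts GrpCat.{0} where
  out m := ⟨fun K => by
    have : HasColimit (Discrete.functor fun i : Fin m => K.obj ⟨i⟩) :=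
      ⟨⟨_, freeProductIsColimit fun i => K.obj ⟨i⟩⟩⟩
    exact hasColimit_of_iso (F := Discrete.functor fun i : Fin m => K.obj ⟨i⟩)
      Discrete.natIsoFunctor⟩

instance : HasFiniteCoproducts Gr where
  out _ := inferInstance

lemma isFreeAbFG_of_addEquiv {A : Type} [AddCommGroup A] {B : AddCommGrpCat.{0}} (e : A ≃+ B)
    [Module.Free ℤ A] [Module.Finite ℤ A] : isFreeAbFG B :=
  ⟨Module.Free.of_equiv e.toIntLinearEquiv, Module.Finite.equiv e.toIntLinearEquiv⟩

instance (m : ℕ) : isFreeAbFG.IsClosedUnderColimitsOfShape (Discrete (Fin m)) where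
  colimitsOfShape_le X := by
    rintro ⟨c, hc⟩
    have h1 (i : Fin m) : Module.Free ℤ (c.diag.obj ⟨i⟩) := (hc ⟨i⟩).1
    have h2 (i : Fin m) : Module.Finite ℤ (c.diag.obj ⟨i⟩) := (hc ⟨i⟩).2
    let Y : Fin m → AddCommGrpCat.{0} := fun i => c.diag.obj ⟨i⟩
    let e : X ≅ AddCommGrpCat.of (∀ i, Y i) :=
      c.isColimit.coconePointsIsoOfNatIso (colimit.isColimit (Discrete.functor Y))
        Discrete.natIsoFunctor ≪≫ (biproduct.isoCoproduct Y).symm ≪≫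
        AddCommGrpCat.biproductIsoPi Y
    exact isFreeAbFG_of_addEquiv e.addCommGroupIsoToAddEquiv.symm

instance : HasFiniteCoproducts Ab where
  out _ := inferInstance

lemma isFreeAbFG_abelianization (G : GrpCat.{0}) (h : isFreeFG G) :
    isFreeAbFG (CommGrpCat.toAddCommGrp.obj (GrpCat.abelianize.obj G)) := by
  have := h.1
  have := h.2
  have : Group.FG (Abelianization G) :=
    Group.fg_of_surjective (f := Abelianization.of) Quotient.mk_surjective
  have : Module.Finite ℤ (Additive (Abelianization G)) :=
    Module.Finite.iff_addGroup_fg.2 inferInstance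
  let e : FreeAbelianGroup (IsFreeGroup.Generators G) ≃+ Additive (Abelianization G) :=
    MulEquiv.toAdditive (IsFreeGroup.toFreeGroup G).symm.abelianizationCongr
  have : Module.Free ℤ (Additive (Abelianization G)) :=
    Module.Free.of_equiv
      ((FreeAbelianGroup.equivFinsupp _).symm.trans e).toIntLinearEquiv
  exact ⟨this, ‹_›⟩

/-- The abelianization functor `gr ⥤ ab`. -/
def abelianization : Gr ⥤ Ab :=
  isFreeAbFG.lift (isFreeFG.ι ⋙ GrpCat.abelianize ⋙ CommGrpCat.toAddCommGrp)
    fun G => isFreeAbFG_abelianization G.obj G.property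

end

end PolyFun

set_option linter.unusedSectionVars false

namespace PolyFun

noncomputable section

/-! ### Slot-additive maps -/

/-! Suppose that every object of C is a finite sum of copies of E. The theorem rests on recognising
Pol_n(C)/Pol_{n-1}(C) as a module category: F ↦ cr_n(F)(E, …, E), with its action of the monomial n
× n matrices over End(E), is itself a localization functor of Pol_n(C)
(`isLocalization_monomialCrossEffect`).

Two facts give this. The first is that the functor inverts exactly the morphisms with kernel and
cokernel in Pol_{n-1} (`polIso_eq`). Cross effects are exact, and if cr_{n+1}(F) = 0, then elements
of cr_n(F) are additive in each of the n slots (`slotAdditive_push`), so that the vanishing of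
cr_n(F) can be tested at (E, …, E). The second is that the functor has a fully faithful left
adjoint, so that it is a localization at the morphisms it inverts. The adjoint sends M to X ↦ k[C(E,
X)ⁿ] ⊗ M modulo additivity in each slot and compatibility with monomial matrices. Its unit is
invertible because a generator at E + ⋯ + E expands into terms indexed by maps φ from slots to
summands, and cr_n retains only the bijective φ (`gen_ι_retraction`).

A monomial module involves only the monoid End(E) and the additivity relations coming from C(E, E +
E). A full functor which preserves finite coproducts and is bijective on End(E) preserves and
reflects these data, so it induces an equivalence of quotients. Abelianization is such a functor on
gr, with E free of rank one. For ab and E = ℤ, additivity makes a matrix with entries aᵢ act through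
the integer ∏ aᵢ (`MonomialModule.act_eq_smul`), so only the action of 𝔖ₙ remains. -/

lemma sum_over_functions {A κ : Type*} [AddCommGroup A] [Fintype κ] {n : ℕ} {H : Fin n → Type*}
    (d : ∀ i, κ → H i → H i) (P : (∀ i, H i) → A)
    (h : ∀ f i, P f = ∑ j, P (Function.update f i (d i j (f i)))) (f : ∀ i, H i) :
    P f = ∑ φ : Fin n → κ, P fun i => d i (φ i) (f i) := by
  induction n with
  | zero =>
    rw [Fintype.sum_unique]
    exact congrArg P (Subsingleton.elim _ _)
  | succ n ih =>
    -- With slot 0 frozen at `d 0 j (f 0)`, the remaining slots satisfy the same hypothesis, so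
    -- induction expands them.
    have key (j : κ) : P (Function.update f 0 (d 0 j (f 0))) =
        ∑ φ : Fin n → κ, P (Fin.cons (d 0 j (f 0)) fun i => d i.succ (φ i) (f i.succ)) := by
      have := ih (fun i => d i.succ) (fun g => P (Fin.cons (d 0 j (f 0)) g)) (fun g i => by
        rw [h _ i.succ]
        simp [Fin.cons_update]) (Fin.tail f)
      rw [← Fin.cons_self_tail f, Fin.update_cons_zero]
      simpa [Fin.tail] using this
    rw [h f 0, ← (Fin.consEquiv fun _ => κ).sum_comp, Fintype.sum_prod_type]
    refine Finset.sum_congr rfl fun j _ => (key j).trans (Finset.sum_congr rfl fun φ _ => ?_)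
    congr 1
    funext i
    refine Fin.cases ?_ (fun i => ?_) i <;> simp [Fin.consEquiv]

section Slots

variable {C : Type u} [Category.{v} C] [HasFiniteCoproducts C] [HasZeroMorphisms C]

lemma coprod_desc_zero_zero (X Y Z : C) : coprod.desc (0 : X ⟶ Z) (0 : Y ⟶ Z) = 0 := by
  ext <;> simp [coprod.inl_desc, coprod.inr_desc]

/-- A map on families of morphisms to `Y` is slot-additive if in each slot it takes the sum of two
orthogonal morphisms to the sum of the values. -/
def SlotAdditive {A : Type*} [AddCommGroup A] {n : ℕ} {X : Fin n → C} {Y : C}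
    (P : (∀ i, X i ⟶ Y) → A) : Prop :=
  ∀ (f : ∀ i, X i ⟶ Y) (i : Fin n) (g : X i ⟶ Y ⨿ Y),
    P (Function.update f i (g ≫ coprod.desc (𝟙 Y) 0)) +
      P (Function.update f i (g ≫ coprod.desc 0 (𝟙 Y))) =
    P (Function.update f i (g ≫ coprod.desc (𝟙 Y) (𝟙 Y)))

namespace SlotAdditive

variable {A : Type*} [AddCommGroup A] {n : ℕ} {X : Fin n → C}

/-- For g = 0 the additivity relation reads x + x = x. -/
lemma update_zero {Y : C} {P : (∀ i, X i ⟶ Y) → A} (hP : SlotAdditive P) (f : ∀ i, X i ⟶ Y)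
    (i : Fin n) : P (Function.update f i 0) = 0 := by
  simpa using hP f i 0

lemma eq_zero {Y : C} {P : (∀ i, X i ⟶ Y) → A} (hP : SlotAdditive P) (f : ∀ i, X i ⟶ Y)
    (i : Fin n) (h : f i = 0) : P f = 0 := by
  rw [← Function.update_eq_self i f, h, hP.update_zero]

/-- The idempotent of a coproduct which keeps only the summands with index in `S`. -/
def keep {a : ℕ} (Z : Fin a → C) (S : Finset (Fin a)) : ∐ Z ⟶ ∐ Z :=
  Sigma.desc fun j => if j ∈ S then Sigma.ι Z j else 0

lemma update_keep {a : ℕ} {Z : Fin a → C} {P : (∀ i, X i ⟶ ∐ Z) → A} (hP : SlotAdditive P)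
    (f : ∀ i, X i ⟶ ∐ Z) (i : Fin n) (S : Finset (Fin a)) :
    P (Function.update f i (f i ≫ keep Z S)) =
      ∑ j ∈ S, P (Function.update f i (f i ≫ Sigma.π Z j ≫ Sigma.ι Z j)) := by
  induction S using Finset.induction_on with
  | empty =>
    have : keep Z ∅ = 0 := Sigma.hom_ext _ _ fun j => by simp [keep]
    simp [this, hP.update_zero]
  | insert b S hb ih =>
    rw [Finset.sum_insert hb, ← ih, add_comm]
    -- The summands in S go to the left copy and b to the right one. The two projections then
    -- isolate S and b, and the fold map gives `insert b S`.
    let q : ∐ Z ⟶ (∐ Z) ⨿ ∐ Z := Sigma.desc fun j =>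
      if j ∈ S then Sigma.ι Z j ≫ coprod.inl else if j = b then Sigma.ι Z j ≫ coprod.inr else 0
    have h1 : q ≫ coprod.desc (𝟙 _) 0 = keep Z S := Sigma.hom_ext _ _ fun j => by
      by_cases h : j ∈ S
      · simp [q, keep, h, coprod.inl_desc]
      · by_cases h' : j = b
        · subst h'; simp [q, keep, hb, coprod.inr_desc]
        · simp [q, keep, h, h']
    have h2 : q ≫ coprod.desc 0 (𝟙 _) = Sigma.π Z b ≫ Sigma.ι Z b :=
      Sigma.hom_ext _ _ fun j => by
      by_cases h' : j = b
      · subst h'; simp [q, hb, coprod.inr_desc]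
      · by_cases h : j ∈ S <;> simp [q, h, h', Sigma.ι_π_of_ne_assoc, coprod.inl_desc]
    have h3 : q ≫ coprod.desc (𝟙 _) (𝟙 _) = keep Z (insert b S) :=
      Sigma.hom_ext _ _ fun j => by
      by_cases h : j ∈ S
      · simp [q, keep, h, coprod.inl_desc]
      · by_cases h' : j = b
        · subst h'; simp [q, keep, hb, coprod.inr_desc]
        · simp [q, keep, h, h']
    simpa [h1, h2, h3] using (hP f i (f i ≫ q)).symm

lemma expand {a : ℕ} {Z : Fin a → C} {P : (∀ i, X i ⟶ ∐ Z) → A} (hP : SlotAdditive P)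
    (f : ∀ i, X i ⟶ ∐ Z) :
    P f = ∑ φ : Fin n → Fin a, P fun i => f i ≫ Sigma.π Z (φ i) ≫ Sigma.ι Z (φ i) := by
  refine sum_over_functions (fun _ j g => g ≫ Sigma.π Z j ≫ Sigma.ι Z j) P (fun f i => ?_) f
  rw [← hP.update_keep]
  have : keep Z Finset.univ = 𝟙 _ := Sigma.hom_ext _ _ fun j => by simp [keep]
  simp [this]

end SlotAdditive

/-! ### Elements of cross effects -/

variable {k : Type t} [CommRing k]

/-- The image of `y ∈ F(X₁ + ⋯ + Xₙ)` under the morphism with components `f i : X i ⟶ Y`. -/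
def push (F : C ⥤ ModuleCat.{w} k) {n : ℕ} {X : Fin n → C} (y : F.obj (∐ X)) {Y : C}
    (f : ∀ i, X i ⟶ Y) : F.obj Y :=
  (F.map (Sigma.desc f)).hom y

section

variable (F : C ⥤ ModuleCat.{w} k) {n : ℕ} {X : Fin n → C}

lemma map_push (y : F.obj (∐ X)) {Y Z : C} (f : ∀ i, X i ⟶ Y) (g : Y ⟶ Z) :
    (F.map g).hom (push F y f) = push F y fun i => f i ≫ g := by
  have : (Sigma.desc fun i => f i ≫ g) = Sigma.desc f ≫ g := Sigma.hom_ext _ _ fun i => by simp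
  simp [push, this]

lemma push_ι (y : F.obj (∐ X)) : push F y (Sigma.ι X) = y := by
  have : Sigma.desc (Sigma.ι X) = 𝟙 _ := Sigma.hom_ext _ _ fun i => by simp
  simp [push, this]

lemma push_push {m : ℕ} {W : Fin m → C} (y : F.obj (∐ X)) (f : ∀ i, X i ⟶ ∐ W) {Y : C}
    (g : ∀ i, W i ⟶ Y) :
    push F (push F y f) g = push F y fun i => f i ≫ Sigma.desc g :=
  map_push F y f _

variable {F} in
-- A morphism that is zero on the i-th summand factors through the i-th deletion.
lemma push_eq_zero {y : F.obj (∐ X)} (hy : y ∈ crossEffect F X) {Y : C} (f : ∀ i, X i ⟶ Y)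
    (i : Fin n) (hi : f i = 0) : push F y f = 0 := by
  have : Sigma.desc f = deletion X i ≫ Sigma.desc fun j => f j := Sigma.hom_ext _ _ fun j => by
    by_cases h : j = i
    · subst h; simp [deletion, hi]
    · simp [deletion, h]
  simp only [crossEffect, Submodule.mem_iInf, LinearMap.mem_ker] at hy
  rw [push, this, F.map_comp, ModuleCat.hom_comp, LinearMap.comp_apply, hy i, map_zero]

variable {F} in
-- Replaces the deletions, whose targets vary, by commuting idempotent endomorphisms of a single
-- coproduct, which can be composed. The deletion of i absorbs the i-th idempotent.
lemma mem_crossEffect_iff {y : F.obj (∐ X)} : y ∈ crossEffect F X ↔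
    ∀ i, push F y (Function.update (Sigma.ι X) i 0) = 0 := by
  refine ⟨fun hy i => push_eq_zero hy _ i (by simp), fun h => ?_⟩
  simp only [crossEffect, Submodule.mem_iInf, LinearMap.mem_ker]
  intro i
  have := congrArg (F.map (deletion X i)).hom (h i)
  rw [map_push, map_zero] at this
  rw [← this, push]
  congr 3
  refine Sigma.hom_ext _ _ fun j => ?_
  by_cases h : j = i
  · subst h; simp [deletion]
  · simp [h]

/-- The defect of additivity in slot i is the image, under the fold map, of an element of
cr_{n+1}(F)(Y, …, Y), which is zero. -/
lemma slotAdditive_push (hF : ∀ W : Fin (n + 1) → C, crossEffect F W = ⊥)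
    {y : F.obj (∐ X)} (hy : y ∈ crossEffect F X) (Y : C) :
    SlotAdditive fun f : ∀ i, X i ⟶ Y => push F y f := by
  intro f i g
  let W : Fin (n + 1) → C := fun _ => Y
  -- Slot j is sent to summand j + 1. Summand 0 is spare: r sends the second half of g there and the
  -- first half to summand i + 1.
  let c : ∀ i, X i ⟶ ∐ W := fun j => f j ≫ Sigma.ι W j.succ
  let z (r : X i ⟶ ∐ W) : F.obj (∐ W) := push F y (Function.update c i r)
  let r : Y ⨿ Y ⟶ ∐ W := coprod.desc (Sigma.ι W i.succ) (Sigma.ι W 0)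
  have hzmap (s : X i ⟶ ∐ W) {V : C} (q : ∐ W ⟶ V) :
      (F.map q).hom (z s) = push F y (Function.update (fun j => c j ≫ q) i (s ≫ q)) := by
    rw [map_push]
    congr 1
    funext j
    by_cases hj : j = i
    · subst hj; simp
    · simp [hj]
  -- Deleting summand 0 identifies the first two terms and kills the third. Deleting summand i + 1
  -- identifies the first and third and kills the second. Any other deletion kills all three.
  have hmem : z (g ≫ r) - z (g ≫ coprod.desc (𝟙 Y) 0 ≫ Sigma.ι W i.succ) -
      z (g ≫ coprod.desc 0 (𝟙 Y) ≫ Sigma.ι W 0) ∈ crossEffect F W := by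
    rw [mem_crossEffect_iff]
    intro l
    rw [push, map_sub, map_sub, hzmap, hzmap, hzmap]
    refine Fin.cases ?_ (fun j => ?_) l
    · have e1 : (g ≫ r) ≫ Sigma.desc (Function.update (Sigma.ι W) 0 0) =
          (g ≫ coprod.desc (𝟙 Y) 0 ≫ Sigma.ι W i.succ) ≫
            Sigma.desc (Function.update (Sigma.ι W) 0 0) := by
        simp only [Category.assoc]
        congr 1
        ext <;> simp [r]
      have e2 : (g ≫ coprod.desc 0 (𝟙 Y) ≫ Sigma.ι W 0) ≫
          Sigma.desc (Function.update (Sigma.ι W) 0 0) = 0 := by simp [coprod_desc_zero_zero]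
      rw [e1, e2, push_eq_zero hy (Function.update _ i 0) i (by simp)]
      simp
    · by_cases hj : j = i
      · subst hj
        have e1 : (g ≫ r) ≫ Sigma.desc (Function.update (Sigma.ι W) j.succ 0) =
            (g ≫ coprod.desc 0 (𝟙 Y) ≫ Sigma.ι W 0) ≫
              Sigma.desc (Function.update (Sigma.ι W) j.succ 0) := by
          simp only [Category.assoc]
          congr 1
          ext <;> simp [r]
        have e2 : (g ≫ coprod.desc (𝟙 Y) 0 ≫ Sigma.ι W j.succ) ≫
            Sigma.desc (Function.update (Sigma.ι W) j.succ 0) = 0 := by simp [coprod_desc_zero_zero]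
        rw [e1, e2, push_eq_zero hy (Function.update _ j 0) j (by simp)]
        simp
      · rw [push_eq_zero hy _ j (by simp [hj, c]), push_eq_zero hy _ j (by simp [hj, c]),
          push_eq_zero hy _ j (by simp [hj, c])]
        simp
  rw [hF W, Submodule.mem_bot, sub_sub, sub_eq_zero] at hmem
  let p : ∐ W ⟶ Y := Sigma.desc fun _ => 𝟙 Y
  have := congrArg (F.map p).hom hmem
  rw [map_add, hzmap, hzmap, hzmap] at this
  have e3 : r ≫ p = coprod.desc (𝟙 Y) (𝟙 Y) := by
    ext <;> simp [r, p, W]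
  have e4 : (fun j => c j ≫ p) = f := by
    funext j; simp [c, p, W]
  have e5 (l : Fin (n + 1)) : Sigma.ι W l ≫ p = 𝟙 Y := by simp [p]
  simp only [Category.assoc, e3, e4, e5] at this
  erw [Category.comp_id, Category.comp_id] at this
  exact this.symm

end

end Slots

section Exactness

variable {C : Type u} [Category.{v} C] [HasFiniteCoproducts C] [HasZeroMorphisms C]
variable {k : Type t} [CommRing k]

/-! ### Exactness of cross effects -/

lemma push_mem_crossEffect {F : C ⥤ ModuleCat.{w} k} {n : ℕ} {X W : Fin n → C} {y : F.obj (∐ X)}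
    (hy : y ∈ crossEffect F X) (h : ∀ i, X i ⟶ W i) :
    push F y (fun i => h i ≫ Sigma.ι W i) ∈ crossEffect F W := by
  rw [mem_crossEffect_iff]
  intro i
  rw [push_push]
  exact push_eq_zero hy _ i (by simp)

lemma app_push {F G : C ⥤ ModuleCat.{w} k} (α : F ⟶ G) {n : ℕ} {X : Fin n → C} (y : F.obj (∐ X))
    {Y : C} (f : ∀ i, X i ⟶ Y) :
    (α.app Y).hom (push F y f) = push G ((α.app (∐ X)).hom y) f := by
  simp only [push, ← LinearMap.comp_apply, ← ModuleCat.hom_comp, α.naturality]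

/-- After X₁ + ⋯ + Xₙ is identified with a sum of copies of E, slot-additivity writes x as a sum of
terms, each of which is the image of an element of cr_n(F)(E, …, E). -/
lemma crossEffect_eq_bot_of_finiteSums {E : C} (hE : ∀ X, finiteSums E X)
    {F : C ⥤ ModuleCat.{w} k} {n : ℕ} (hF : ∀ W : Fin (n + 1) → C, crossEffect F W = ⊥)
    (h : crossEffect F (fun _ : Fin n => E) = ⊥) (X : Fin n → C) : crossEffect F X = ⊥ := by
  refine (Submodule.eq_bot_iff _).2 fun x hx => ?_
  obtain ⟨m, ⟨e⟩⟩ := hE (∐ X)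
  have he : (F.map e.hom).hom x = 0 := by
    rw [← push_ι F x, map_push,
      (slotAdditive_push F hF hx _).expand (Z := fun _ : Fin m => E)]
    refine Finset.sum_eq_zero fun φ _ => ?_
    have key := push_mem_crossEffect hx (W := fun _ : Fin n => E) fun i =>
      Sigma.ι X i ≫ e.hom ≫ Sigma.π (fun _ : Fin m => E) (φ i)
    rw [h, Submodule.mem_bot] at key
    have := congrArg (fun y => push F y fun i => Sigma.ι (fun _ : Fin m => E) (φ i)) key
    simp only [push_push] at this
    simp only [Category.assoc, Sigma.ι_desc] at this ⊢
    exact this.trans (map_zero _)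
  have := congrArg (F.map e.inv).hom he
  rwa [← LinearMap.comp_apply, ← ModuleCat.hom_comp, ← F.map_comp, e.hom_inv_id, F.map_id,
    map_zero] at this

/-- The lifting property behind exactness of cross effects. Applying 1 - ρ_b for each summand b,
with ρ_b the idempotent deleting b, moves x into the cross effect. The image under α does not
change, since ρ_b already kills it, and the ρ_b commute, so earlier vanishing persists. -/
lemma exists_mem_crossEffect {F G : C ⥤ ModuleCat.{w} k} (α : F ⟶ G) {n : ℕ} {X : Fin n → C}
    (x : F.obj (∐ X)) (hx : (α.app (∐ X)).hom x ∈ crossEffect G X) :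
    ∃ x' ∈ crossEffect F X, (α.app (∐ X)).hom x' = (α.app (∐ X)).hom x := by
  suffices ∀ S : Finset (Fin n), ∃ x', (α.app (∐ X)).hom x' = (α.app (∐ X)).hom x ∧
      ∀ i ∈ S, push F x' (Function.update (Sigma.ι X) i 0) = 0 by
    obtain ⟨x', h1, h2⟩ := this Finset.univ
    exact ⟨x', mem_crossEffect_iff.2 fun i => h2 i (Finset.mem_univ i), h1⟩
  intro S
  induction S using Finset.induction_on with
  | empty => exact ⟨x, rfl, by simp⟩
  | insert b S hb ih =>
    obtain ⟨x', h1, h2⟩ := ih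
    refine ⟨x' - push F x' (Function.update (Sigma.ι X) b 0), ?_, fun i hi => ?_⟩
    · rw [map_sub, app_push, h1, push_eq_zero hx _ b (by simp), sub_zero]
    · rw [push, map_sub]
      change push F x' _ - push F (push F x' _) _ = 0
      rw [push_push, sub_eq_zero]
      by_cases hib : i = b
      · subst hib
        congr 1
        funext j
        by_cases hj : j = i
        · subst hj; simp
        · simp [hj]
      · have hi : i ∈ S := (Finset.mem_insert.1 hi).resolve_left hib
        have h3 := congrArg (fun y => push F y (Function.update (Sigma.ι X) b 0)) (h2 i hi)
        simp only [push_push] at h3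
        rw [h2 i hi]
        have h0 : push F (0 : F.obj (∐ X)) (Function.update (Sigma.ι X) b 0) = 0 := map_zero _
        rw [h0] at h3
        rw [← h3]
        congr 1
        funext j
        by_cases hj : j = i
        · subst hj; simp [hib]
        · by_cases hjb : j = b
          · subst hjb; simp [hj]
          · simp [hj, hjb]

/-! ### Pointwise kernels and cokernels, and their cross effects. -/

section

variable {F G : C ⥤ ModuleCat.{w} k} (α : F ⟶ G)

lemma kernel_ι_app_injective (Y : C) : Function.Injective ((kernel.ι α).app Y).hom :=
  (ModuleCat.mono_iff_injective _).1 inferInstance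

lemma cokernel_π_app_surjective (Y : C) : Function.Surjective ((cokernel.π α).app Y).hom :=
  (ModuleCat.epi_iff_surjective _).1 inferInstance

lemma app_kernel_ι_app {Y : C} (z : (kernel α).obj Y) :
    (α.app Y).hom (((kernel.ι α).app Y).hom z) = 0 := by
  rw [← LinearMap.comp_apply, ← ModuleCat.hom_comp, ← NatTrans.comp_app, kernel.condition]
  rfl

lemma cokernel_π_app_app {Y : C} (x : F.obj Y) :
    ((cokernel.π α).app Y).hom ((α.app Y).hom x) = 0 := by
  rw [← LinearMap.comp_apply, ← ModuleCat.hom_comp, ← NatTrans.comp_app, cokernel.condition]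
  rfl

lemma exists_kernel_ι_app {Y : C} (x : F.obj Y) (hx : (α.app Y).hom x = 0) :
    ∃ z, ((kernel.ι α).app Y).hom z = x := by
  have h := (ShortComplex.exact_kernel α).map ((evaluation C (ModuleCat.{w} k)).obj Y)
  exact (ShortComplex.moduleCat_exact_iff _).1 h x hx

lemma exists_app_of_cokernel_π {Y : C} (y : G.obj Y) (hy : ((cokernel.π α).app Y).hom y = 0) :
    ∃ x, (α.app Y).hom x = y := by
  have h := (ShortComplex.exact_cokernel α).map ((evaluation C (ModuleCat.{w} k)).obj Y)
  exact (ShortComplex.moduleCat_exact_iff _).1 h y hy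

variable {n : ℕ} (X : Fin n → C)

/-- Here and for the cokernel below, `exists_mem_crossEffect` reduces the claim to pointwise
exactness: the cross effect of the kernel is the kernel on cross effects. -/
lemma crossEffect_kernel_eq_bot_iff : crossEffect (kernel α) X = ⊥ ↔
    ∀ x ∈ crossEffect F X, (α.app (∐ X)).hom x = 0 → x = 0 := by
  rw [Submodule.eq_bot_iff]
  refine ⟨fun h x hx hx0 => ?_, fun h z hz => ?_⟩
  · obtain ⟨z, rfl⟩ := exists_kernel_ι_app α x hx0
    obtain ⟨z', hz', h'⟩ := exists_mem_crossEffect (kernel.ι α) z hx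
    rw [← h', h z' hz', map_zero]
  · refine kernel_ι_app_injective α _ ?_
    rw [h _ (app_mem (kernel.ι α) X z hz) (app_kernel_ι_app α z), map_zero]

lemma crossEffect_cokernel_eq_bot_iff : crossEffect (cokernel α) X = ⊥ ↔
    ∀ y ∈ crossEffect G X, ∃ x ∈ crossEffect F X, (α.app (∐ X)).hom x = y := by
  rw [Submodule.eq_bot_iff]
  refine ⟨fun h y hy => ?_, fun h q hq => ?_⟩
  · obtain ⟨x, rfl⟩ := exists_app_of_cokernel_π α y (h _ (app_mem (cokernel.π α) X y hy))
    exact exists_mem_crossEffect α x hy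
  · obtain ⟨y, rfl⟩ := cokernel_π_app_surjective α _ q
    obtain ⟨y', hy', h'⟩ := exists_mem_crossEffect (cokernel.π α) y hq
    obtain ⟨x, -, rfl⟩ := h y' hy'
    rw [← h', cokernel_π_app_app]

lemma crossEffect_kernel_eq_bot (h : crossEffect F X = ⊥) : crossEffect (kernel α) X = ⊥ :=
  (crossEffect_kernel_eq_bot_iff α X).2 fun x hx _ => by rwa [h, Submodule.mem_bot] at hx

lemma crossEffect_cokernel_eq_bot (h : crossEffect G X = ⊥) : crossEffect (cokernel α) X = ⊥ :=
  (crossEffect_cokernel_eq_bot_iff α X).2 fun y hy => by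
    rw [h, Submodule.mem_bot] at hy
    exact ⟨0, zero_mem _, by rw [map_zero, hy]⟩

end

/-- For polynomial functors of degree at most `n` on a category generated by `E`, the degree is
less than `n` if and only if `cr_n(F)(E, …, E)` vanishes. -/
lemma degreeLT_iff {E : C} (hE : ∀ X, finiteSums E X) {F : C ⥤ ModuleCat.{w} k} {n : ℕ}
    (hF : DegreeLT.{w} C k (n + 1) F) :
    DegreeLT.{w} C k n F ↔ crossEffect F (fun _ : Fin n => E) = ⊥ := by
  cases n with
  | zero =>
    refine ⟨fun h => ?_, fun h => ?_⟩
    · have : IsZero (F.obj (∐ fun _ : Fin 0 => E)) := h.obj _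
      have := ModuleCat.subsingleton_of_isZero this
      exact Subsingleton.elim _ _
    · refine Functor.isZero _ fun Y => ?_
      have h1 := crossEffect_eq_bot_of_finiteSums hE hF h
      have : Subsingleton (F.obj Y) := by
        refine subsingleton_of_forall_eq 0 fun y => ?_
        -- For n = 0 the hypothesis `h` says that F vanishes at the empty sum. Deleting the only
        -- summand of `W` factors through that empty sum, so every y ∈ F(Y) gives an element of
        -- cr_1(F)(Y) = 0.
        let W : Fin 1 → C := fun _ => Y
        have h0 : push F ((F.map (Sigma.ι W 0)).hom y) (Sigma.ι W) = 0 := by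
          have hmem : (F.map (Sigma.ι W 0)).hom y ∈ crossEffect F W := by
            rw [mem_crossEffect_iff]
            intro i
            obtain rfl : i = 0 := Subsingleton.elim _ _
            let q : Y ⟶ ∐ fun _ : Fin 0 => E := 0
            have hq : (F.map q).hom y = 0 := by
              have : (F.map q).hom y ∈ crossEffect F fun _ : Fin 0 => E := by
                rw [mem_crossEffect_iff]
                exact fun i => i.elim0
              rwa [h, Submodule.mem_bot] at this
            have e : Sigma.ι W 0 ≫ Sigma.desc (Function.update (Sigma.ι W) 0 0) =
                q ≫ (0 : _ ⟶ ∐ W) := by simp [q]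
            rw [push, ← LinearMap.comp_apply, ← ModuleCat.hom_comp, ← F.map_comp, e, F.map_comp,
              ModuleCat.hom_comp, LinearMap.comp_apply, hq, map_zero]
          rw [hF W, Submodule.mem_bot] at hmem
          rw [hmem]
          exact map_zero _
        rw [push_ι] at h0
        have := congrArg (F.map (Sigma.π W 0)).hom h0
        rwa [← LinearMap.comp_apply, ← ModuleCat.hom_comp, ← F.map_comp, Sigma.ι_π_eq_id,
          F.map_id, map_zero] at this
      exact ModuleCat.isZero_of_subsingleton _
  | succ n =>
    exact ⟨fun h => h _, crossEffect_eq_bot_of_finiteSums hE hF⟩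

end Exactness

section MonomialModules

variable {C : Type u} [Category.{v} C] [HasFiniteCoproducts C] [HasZeroMorphisms C]

/-! ### Modules over monomial matrices -/

/-- The endomorphism of `E + ⋯ + E` which maps the `i`-th summand to the `σ i`-th one by `a i`. -/
def monomial {E : C} {n : ℕ} (a : Fin n → (E ⟶ E)) (σ : Equiv.Perm (Fin n)) :
    (∐ fun _ : Fin n => E) ⟶ ∐ fun _ : Fin n => E :=
  Sigma.desc fun i => a i ≫ Sigma.ι (fun _ : Fin n => E) (σ i)

/-- A `k`-module with an action of the monomial `n × n` matrices with entries in the endomorphisms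
of `E` which is additive in each entry. These are the modules over the wreath product of `Λ(E)`
with the symmetric group. -/
structure MonomialModule (k : Type t) [CommRing k] (E : C) (n : ℕ) where
  /-- the underlying module -/
  carrier : ModuleCat.{w} k
  /-- the action of a monomial matrix -/
  act : (Fin n → (E ⟶ E)) → Equiv.Perm (Fin n) → carrier →ₗ[k] carrier
  act_one (m : carrier) : act (fun _ => 𝟙 E) 1 m = m
  act_act (a b : Fin n → (E ⟶ E)) (σ τ : Equiv.Perm (Fin n)) (m : carrier) :
    act b τ (act a σ m) = act (fun i => a i ≫ b (σ i)) (τ * σ) m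
  slotAdditive_act (σ : Equiv.Perm (Fin n)) (m : carrier) :
    SlotAdditive fun a : Fin n → (E ⟶ E) => act a σ m

namespace MonomialModule

variable {k : Type t} [CommRing k] {E : C} {n : ℕ}

/-- Morphisms of modules over monomial matrices. -/
@[ext]
structure Hom (M N : MonomialModule.{w} k E n) where
  /-- the underlying linear map -/
  lin : M.carrier →ₗ[k] N.carrier
  map_act (a : Fin n → (E ⟶ E)) (σ : Equiv.Perm (Fin n)) (m : M.carrier) :
    lin (M.act a σ m) = N.act a σ (lin m)

instance : Category (MonomialModule.{w} k E n) where
  Hom := Hom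
  id M := ⟨LinearMap.id, fun _ _ _ => rfl⟩
  comp f g := ⟨g.lin ∘ₗ f.lin, fun a σ m => by simp [f.map_act, g.map_act]⟩

@[ext]
lemma hom_ext {M N : MonomialModule.{w} k E n} {f g : M ⟶ N} (h : ∀ m, f.lin m = g.lin m) :
    f = g :=
  Hom.ext (LinearMap.ext h)

@[simp]
lemma id_lin (M : MonomialModule.{w} k E n) : Hom.lin (𝟙 M) = LinearMap.id := rfl

@[simp]
lemma comp_lin {M N P : MonomialModule.{w} k E n} (f : M ⟶ N) (g : N ⟶ P) :
    (f ≫ g).lin = g.lin ∘ₗ f.lin := rfl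

/-- An equivariant linear equivalence is an isomorphism. -/
@[simps]
def isoMk {M N : MonomialModule.{w} k E n} (e : M.carrier ≃ₗ[k] N.carrier)
    (he : ∀ a σ m, e (M.act a σ m) = N.act a σ (e m)) : M ≅ N where
  hom := ⟨e.toLinearMap, he⟩
  inv := ⟨e.symm.toLinearMap, fun a σ m => by
    apply e.injective
    simp [he]⟩
  hom_inv_id := by ext m; simp
  inv_hom_id := by ext m; simp

lemma isIso_iff {M N : MonomialModule.{w} k E n} (f : M ⟶ N) :
    IsIso f ↔ Function.Bijective f.lin := by
  refine ⟨fun _ => ?_, fun h => ?_⟩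
  · refine Function.bijective_iff_has_inverse.2 ⟨(inv f).lin, fun m => ?_, fun m => ?_⟩
    · exact congrArg (fun g => Hom.lin g m) (IsIso.hom_inv_id f)
    · exact congrArg (fun g => Hom.lin g m) (IsIso.inv_hom_id f)
  · exact (isoMk (LinearEquiv.ofBijective f.lin h) f.map_act).isIso_hom

end MonomialModule

variable {k : Type t} [CommRing k]

lemma map_monomial (F : C ⥤ ModuleCat.{w} k) {E : C} {n : ℕ}
    (y : F.obj (∐ fun _ : Fin n => E)) (a : Fin n → (E ⟶ E)) (σ : Equiv.Perm (Fin n)) :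
    (F.map (monomial a σ)).hom y = push F y fun i => a i ≫ Sigma.ι (fun _ : Fin n => E) (σ i) :=
  rfl

lemma push_map_monomial (F : C ⥤ ModuleCat.{w} k) {E : C} {n : ℕ}
    (y : F.obj (∐ fun _ : Fin n => E)) (a : Fin n → (E ⟶ E)) (σ : Equiv.Perm (Fin n))
    {Y : C} (f : ∀ _ : Fin n, E ⟶ Y) :
    push F ((F.map (monomial a σ)).hom y) f = push F y fun i => a i ≫ f (σ i) := by
  rw [map_monomial, push_push]
  simp

lemma map_monomial_mem (F : C ⥤ ModuleCat.{w} k) {E : C} {n : ℕ} (a : Fin n → (E ⟶ E))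
    (σ : Equiv.Perm (Fin n)) (y : F.obj (∐ fun _ : Fin n => E))
    (hy : y ∈ crossEffect F fun _ : Fin n => E) :
    (F.map (monomial a σ)).hom y ∈ crossEffect F fun _ : Fin n => E := by
  rw [mem_crossEffect_iff]
  intro i
  rw [push_map_monomial]
  exact push_eq_zero hy _ (σ.symm i) (by simp)

/-- The monomial matrices act on the cross effect `cr_n(F)(E, …, E)` of a polynomial functor `F`
of degree at most `n`. -/
abbrev monomialCrossEffectObj (E : C) (n : ℕ) (F : Pol.{w} C k n) : MonomialModule.{w} k E n where
  carrier := ModuleCat.of k (crossEffect F.obj fun _ : Fin n => E)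
  act a σ := (F.obj.map (monomial a σ)).hom.restrict (map_monomial_mem F.obj a σ)
  act_one y := Subtype.ext <| by
    simp [LinearMap.restrict_apply, map_monomial, push_ι]
  act_act a b σ τ y := Subtype.ext <| by
    simp [LinearMap.restrict_apply, map_monomial, push_push]
  slotAdditive_act σ y a i g := Subtype.ext <| by
    -- Both halves of g are followed by the inclusion of the summand σ i, so that additivity holds
    -- for morphisms into the whole of E + ⋯ + E.
    have := (slotAdditive_push F.obj F.property y.2 (∐ fun _ : Fin n => E))
      (fun j => a j ≫ Sigma.ι (fun _ : Fin n => E) (σ j)) i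
      (g ≫ coprod.map (Sigma.ι (fun _ : Fin n => E) (σ i)) (Sigma.ι (fun _ : Fin n => E) (σ i)))
    have key (r : E ⟶ E) :
        ((F.obj.map (monomial (Function.update a i r) σ)).hom y.1) = push F.obj y.1
          (Function.update (fun j => a j ≫ Sigma.ι (fun _ : Fin n => E) (σ j)) i
            (r ≫ Sigma.ι (fun _ : Fin n => E) (σ i))) := by
      rw [map_monomial]
      congr 1
      funext j
      by_cases hj : j = i
      · subst hj; simp
      · simp [hj]
    change (F.obj.map (monomial _ σ)).hom y.1 + (F.obj.map (monomial _ σ)).hom y.1 =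
      (F.obj.map (monomial _ σ)).hom y.1
    rw [key, key, key]
    simpa using this

/-- The functor `F ↦ cr_n(F)(E, …, E)` from polynomial functors of degree at most `n` to
modules over monomial matrices. -/
abbrev monomialCrossEffect (k : Type t) [CommRing k] (E : C) (n : ℕ) :
    Pol.{w} C k n ⥤ MonomialModule.{w} k E n where
  obj F := monomialCrossEffectObj E n F
  map α := ⟨(α.hom.app (∐ fun _ : Fin n => E)).hom.restrict (app_mem α.hom fun _ => E),
    fun a σ (y : crossEffect _ fun _ : Fin n => E) => Subtype.ext (app_push α.hom y.1 _)⟩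

/-- A morphism of `Pol_n(C)` has kernel and cokernel of degree less than `n` if and only if
it induces an isomorphism on the cross effects `cr_n(-)(E, …, E)`. -/
lemma polIso_eq {E : C} (hE : ∀ X, finiteSums E X) (n : ℕ) : polIso.{w} C k n =
    (MorphismProperty.isomorphisms _).inverseImage (monomialCrossEffect.{w} k E n) := by
  ext F G α
  rw [MorphismProperty.inverseImage_iff, MorphismProperty.isomorphisms.iff,
    MonomialModule.isIso_iff, polIso,
    degreeLT_iff hE (fun X => crossEffect_kernel_eq_bot α.hom X (F.property X)),
    degreeLT_iff hE (fun X => crossEffect_cokernel_eq_bot α.hom X (G.property X)),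
    crossEffect_kernel_eq_bot_iff, crossEffect_cokernel_eq_bot_iff]
  refine and_congr ?_ ?_
  · refine Iff.trans ?_ (injective_iff_map_eq_zero _).symm
    refine ⟨fun h (x : crossEffect F.obj fun _ : Fin n => E) hx =>
      Subtype.ext (h x.1 x.2 (congrArg Subtype.val hx)), fun h x hx hx0 => ?_⟩
    exact congrArg Subtype.val (h ⟨x, hx⟩ (Subtype.ext hx0))
  · refine ⟨fun h (y : crossEffect G.obj fun _ : Fin n => E) => ?_, fun h y hy => ?_⟩
    · obtain ⟨x, hx, h'⟩ := h y.1 y.2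
      exact ⟨⟨x, hx⟩, Subtype.ext h'⟩
    · obtain ⟨x, h'⟩ := h ⟨y, hy⟩
      exact ⟨x.1, x.2, congrArg Subtype.val h'⟩

end MonomialModules

/-- There is a linear endomorphism of `F(X₁ + ⋯ + Xₙ)` which is the identity on the cross effect
and which vanishes on the elements that are fixed by the deletion of some summand. -/
lemma exists_crossEffect_projector {C : Type u} [Category.{v} C] [HasFiniteCoproducts C]
    [HasZeroMorphisms C] {k : Type t} [CommRing k] (F : C ⥤ ModuleCat.{w} k) {n : ℕ}
    (X : Fin n → C) :
    ∃ D : F.obj (∐ X) →ₗ[k] F.obj (∐ X), (∀ y ∈ crossEffect F X, D y = y) ∧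
      ∀ l z, push F z (Function.update (Sigma.ι X) l 0) = z → D z = 0 := by
  suffices ∀ S : Finset (Fin n), ∃ D : F.obj (∐ X) →ₗ[k] F.obj (∐ X),
      (∀ y ∈ crossEffect F X, D y = y) ∧
      ∀ l ∈ S, ∀ z, push F z (Function.update (Sigma.ι X) l 0) = z → D z = 0 by
    obtain ⟨D, h1, h2⟩ := this Finset.univ
    exact ⟨D, h1, fun l => h2 l (Finset.mem_univ l)⟩
  intro S
  induction S using Finset.induction_on with
  | empty => exact ⟨LinearMap.id, fun _ _ => rfl, by simp⟩
  | insert b S hb ih =>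
    obtain ⟨D, h1, h2⟩ := ih
    -- The projector is the product of the operators 1 - ρ_b over all summands b.
    let ρ : F.obj (∐ X) →ₗ[k] F.obj (∐ X) :=
      (F.map (Sigma.desc (Function.update (Sigma.ι X) b 0))).hom
    have hρ (z) : ρ z = push F z (Function.update (Sigma.ι X) b 0) := rfl
    refine ⟨D ∘ₗ (LinearMap.id - ρ), fun y hy => ?_, fun l hl z hz => ?_⟩
    · simp [hρ, push_eq_zero hy _ b, h1 y hy]
    · rcases Finset.mem_insert.1 hl with rfl | hl
      · simp [hρ, hz]
      · refine h2 l hl _ ?_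
        -- Deletions of different summands commute, so ρ z is still fixed by the deletion of l.
        have h3 : push F (ρ z) (Function.update (Sigma.ι X) l 0) = ρ z := by
          conv_rhs => rw [hρ, ← hz]
          rw [hρ, push_push, push_push]
          congr 1
          funext j
          by_cases hj : j = b
          · subst hj
            by_cases hjl : j = l
            · subst hjl; simp
            · simp [hjl]
          · by_cases hjl : j = l
            · subst hjl; simp [hj]
            · simp [hj, hjl]
        have h4 : push F ((LinearMap.id - ρ : F.obj (∐ X) →ₗ[k] F.obj (∐ X)) z)
            (Function.update (Sigma.ι X) l 0) =
            push F z (Function.update (Sigma.ι X) l 0) -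
              push F (ρ z) (Function.update (Sigma.ι X) l 0) := map_sub _ _ _
        rw [h4, hz, h3]
        rfl

namespace MonomialModule

variable {C : Type u} [Category.{v} C] [HasFiniteCoproducts C] [HasZeroMorphisms C]
variable {k : Type t} [CommRing k] {E : C} {n : ℕ} (M : MonomialModule.{max v w} k E n)

/-! ### The polynomial functor attached to a module over monomial matrices -/

/-- The relations of additivity in each slot and of compatibility with monomial matrices. -/
def relations (X : C) : Submodule k ((Fin n → (E ⟶ X)) →₀ M.carrier) :=
  Submodule.span k
    ({r | ∃ (f : Fin n → (E ⟶ X)) (i : Fin n) (g : E ⟶ X ⨿ X) (m : M.carrier), r =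
        Finsupp.single (Function.update f i (g ≫ coprod.desc (𝟙 X) 0)) m +
          Finsupp.single (Function.update f i (g ≫ coprod.desc 0 (𝟙 X))) m -
          Finsupp.single (Function.update f i (g ≫ coprod.desc (𝟙 X) (𝟙 X))) m} ∪
      {r | ∃ (f : Fin n → (E ⟶ X)) (a : Fin n → (E ⟶ E)) (σ : Equiv.Perm (Fin n))
        (m : M.carrier), r = Finsupp.single (fun i => a i ≫ f (σ i)) m -
          Finsupp.single f (M.act a σ m)})

/-- The value at `X` of the polynomial functor attached to `M`. -/
abbrev Extension (X : C) : Type (max v w) := ((Fin n → (E ⟶ X)) →₀ M.carrier) ⧸ M.relations X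

variable {M} in
/-- The generators of the value at `X` of the polynomial functor attached to `M`. -/
def gen {X : C} (f : Fin n → (E ⟶ X)) : M.carrier →ₗ[k] M.Extension X :=
  (M.relations X).mkQ ∘ₗ Finsupp.lsingle f

lemma slotAdditive_gen (X : C) (m : M.carrier) :
    SlotAdditive fun f : Fin n → (E ⟶ X) => gen f m := by
  intro f i g
  rw [← sub_eq_zero]
  exact (Submodule.Quotient.mk_eq_zero _).2 (Submodule.subset_span (Or.inl ⟨f, i, g, m, rfl⟩))

lemma gen_act {X : C} (f : Fin n → (E ⟶ X)) (a : Fin n → (E ⟶ E)) (σ : Equiv.Perm (Fin n))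
    (m : M.carrier) : gen f (M.act a σ m) = gen (fun i => a i ≫ f (σ i)) m := by
  symm
  rw [← sub_eq_zero]
  exact (Submodule.Quotient.mk_eq_zero _).2 (Submodule.subset_span (Or.inr ⟨f, a, σ, m, rfl⟩))

variable {M} in
lemma extension_hom_ext {X : C} {N : Type*} [AddCommGroup N] [Module k N]
    {p q : M.Extension X →ₗ[k] N} (h : ∀ f m, p (gen f m) = q (gen f m)) : p = q :=
  Submodule.linearMap_qext _ (Finsupp.lhom_ext fun f m => h f m)

/-- A family of linear maps satisfying the relations extends to the quotient. -/
def extensionLift {X : C} {N : Type*} [AddCommGroup N] [Module k N]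
    (p : (Fin n → (E ⟶ X)) → M.carrier →ₗ[k] N)
    (hadd : ∀ m, SlotAdditive fun f => p f m)
    (hact : ∀ f a σ m, p f (M.act a σ m) = p (fun i => a i ≫ f (σ i)) m) :
    M.Extension X →ₗ[k] N :=
  (M.relations X).liftQ (Finsupp.lsum k p) <| by
    refine Submodule.span_le.2 ?_
    rintro r (⟨f, i, g, m, rfl⟩ | ⟨f, a, σ, m, rfl⟩)
    · simp only [SetLike.mem_coe, LinearMap.mem_ker, map_add, map_sub, Finsupp.lsum_single,
        sub_eq_zero]
      exact hadd m f i g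
    · simp only [SetLike.mem_coe, LinearMap.mem_ker, map_sub, Finsupp.lsum_single, sub_eq_zero]
      exact (hact f a σ m).symm

@[simp]
lemma extensionLift_gen {X : C} {N : Type*} [AddCommGroup N] [Module k N]
    (p : (Fin n → (E ⟶ X)) → M.carrier →ₗ[k] N)
    (hadd : ∀ m, SlotAdditive fun f => p f m)
    (hact : ∀ f a σ m, p f (M.act a σ m) = p (fun i => a i ≫ f (σ i)) m) (f m) :
    M.extensionLift p hadd hact (gen f m) = p f m := by
  refine (Submodule.liftQ_apply _ _ _).trans ?_
  simp

lemma _root_.PolyFun.SlotAdditive.comp_right {A : Type*} [AddCommGroup A] {X : Fin n → C}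
    {Y Z : C} {P : (∀ i, X i ⟶ Z) → A} (hP : SlotAdditive P) (h : Y ⟶ Z) :
    SlotAdditive fun f : ∀ i, X i ⟶ Y => P fun i => f i ≫ h := by
  intro f i g
  have key (r : X i ⟶ Y) : (fun j => Function.update f i r j ≫ h) =
      Function.update (fun j => f j ≫ h) i (r ≫ h) := by
    funext j
    by_cases hj : j = i
    · subst hj; simp
    · simp [hj]
  simpa [key] using hP (fun j => f j ≫ h) i (g ≫ coprod.map h h)

/-- The action of a morphism on the values of the polynomial functor attached to `M`. -/
def extensionMap {X Y : C} (h : X ⟶ Y) : M.Extension X →ₗ[k] M.Extension Y :=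
  M.extensionLift (fun f => gen fun i => f i ≫ h)
    (fun m => (M.slotAdditive_gen Y m).comp_right h)
    (fun f a σ m => by simp only [Category.assoc]; exact M.gen_act _ a σ m)

@[simp]
lemma extensionMap_gen {X Y : C} (h : X ⟶ Y) (f : Fin n → (E ⟶ X)) (m : M.carrier) :
    M.extensionMap h (gen f m) = gen (fun i => f i ≫ h) m := by
  simp [extensionMap]

/-- The polynomial functor attached to `M`. -/
abbrev extension : C ⥤ ModuleCat.{max v w} k where
  obj X := ModuleCat.of k (M.Extension X)
  map {X Y} h := ModuleCat.ofHom (M.extensionMap h)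
  map_id X := ModuleCat.hom_ext <| extension_hom_ext fun f m =>
    (M.extensionMap_gen _ f m).trans (by simp only [Category.comp_id]; rfl)
  map_comp h h' := ModuleCat.hom_ext <| extension_hom_ext fun f m => by simp

lemma push_gen {a : ℕ} {Z : Fin a → C} {Y : C} (f : Fin n → (E ⟶ ∐ Z)) (m : M.carrier)
    (h : ∀ j, Z j ⟶ Y) :
    push M.extension (gen f m) h = gen (M := M) (fun i => f i ≫ Sigma.desc h) m :=
  M.extensionMap_gen _ f m

/-- Deleting a summand outside the range of φ does not affect the term indexed by φ, so the
cross-effect projector kills that term. -/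
lemma push_gen_summands {a : ℕ} {Z : Fin a → C} (f : Fin n → (E ⟶ ∐ Z)) (m : M.carrier)
    (φ : Fin n → Fin a) (l : Fin a) (hl : ∀ i, φ i ≠ l) :
    push M.extension (gen (M := M) (fun i => f i ≫ Sigma.π Z (φ i) ≫ Sigma.ι Z (φ i)) m)
      (Function.update (Sigma.ι Z) l 0) =
    gen (M := M) (fun i => f i ≫ Sigma.π Z (φ i) ≫ Sigma.ι Z (φ i)) m := by
  rw [push_gen]
  congr 2
  funext i
  simp [hl i]

/-- The n slots cannot reach all n + 1 summands, so each term in the expansion of a generator is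
fixed by some deletion. The cross-effect projector is therefore zero. -/
lemma degreeLT_extension : DegreeLT.{max v w} C k (n + 1) M.extension := by
  intro W
  obtain ⟨D, hD1, hD2⟩ := exists_crossEffect_projector M.extension W
  have hD : D = 0 := extension_hom_ext fun f m => by
    rw [(M.slotAdditive_gen (∐ W) m).expand f, map_sum]
    refine Finset.sum_eq_zero fun φ _ => ?_
    have hmiss : ∃ l, ∀ i, φ i ≠ l := by
      by_contra! h
      have := Fintype.card_le_of_surjective φ h
      simp at this
    obtain ⟨l, hl⟩ := hmiss
    exact hD2 l _ (M.push_gen_summands f m φ l hl)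
  refine (Submodule.eq_bot_iff _).2 fun x hx => ?_
  rw [← hD1 x hx, hD]
  rfl

/-- The polynomial functor of degree at most `n` attached to `M`. -/
abbrev extensionPol : Pol.{max v w} C k n := ⟨M.extension, M.degreeLT_extension⟩

lemma gen_ι_mem (m : M.carrier) :
    gen (M := M) (Sigma.ι fun _ : Fin n => E) m ∈
      crossEffect M.extension fun _ : Fin n => E := by
  rw [mem_crossEffect_iff]
  intro i
  rw [push_gen]
  exact (M.slotAdditive_gen _ m).eq_zero _ i (by simp)

/-- The unit of the adjunction. -/
def extensionUnit : M ⟶ (monomialCrossEffect k E n).obj M.extensionPol where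
  lin := LinearMap.codRestrict _ (gen (Sigma.ι fun _ : Fin n => E)) M.gen_ι_mem
  map_act a σ m := Subtype.ext <| (M.gen_act _ a σ m).trans <| by
    refine Eq.trans ?_ (M.extensionMap_gen (monomial a σ) _ m).symm
    simp [monomial]

/-- The inverse of the unit, on the whole value at `E + ⋯ + E`. -/
def retraction : M.Extension (∐ fun _ : Fin n => E) →ₗ[k] M.carrier :=
  -- The term for σ extracts the component of f that sends slot i to summand σ i, that is, the part
  -- of f which is a monomial matrix of shape σ.
  M.extensionLift (fun f => ∑ σ, M.act (fun i => f i ≫ Sigma.π (fun _ : Fin n => E) (σ i)) σ)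
    (fun m f i g => by
      simp only [LinearMap.sum_apply, ← Finset.sum_add_distrib]
      refine Finset.sum_congr rfl fun σ _ => ?_
      have key (r : E ⟶ ∐ fun _ : Fin n => E) :
          (fun j => Function.update f i r j ≫ Sigma.π (fun _ : Fin n => E) (σ j)) =
          Function.update (fun j => f j ≫ Sigma.π (fun _ : Fin n => E) (σ j)) i
            (r ≫ Sigma.π (fun _ : Fin n => E) (σ i)) := by
        funext j
        by_cases hj : j = i
        · subst hj; simp
        · simp [hj]
      have := M.slotAdditive_act σ m (fun j => f j ≫ Sigma.π (fun _ : Fin n => E) (σ j)) i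
        (g ≫ coprod.map (Sigma.π (fun _ : Fin n => E) (σ i)) (Sigma.π (fun _ : Fin n => E) (σ i)))
      simpa [key] using this)
    (fun f a τ m => by
      simp only [LinearMap.sum_apply, act_act]
      refine Fintype.sum_equiv (Equiv.mulRight τ) _ _ fun σ => ?_
      simp)

lemma retraction_gen (f : Fin n → (E ⟶ ∐ fun _ : Fin n => E)) (m : M.carrier) :
    M.retraction (gen f m) =
      ∑ σ, M.act (fun i => f i ≫ Sigma.π (fun _ : Fin n => E) (σ i)) σ m := by
  refine (M.extensionLift_gen _ _ _ f m).trans ?_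
  simp

/-- Only σ = 1 contributes: if σ i ≠ i, then the i-th entry ι_i ≫ π_{σ i} is zero. -/
lemma retraction_gen_ι (m : M.carrier) :
    M.retraction (gen (Sigma.ι fun _ : Fin n => E) m) = m := by
  rw [retraction_gen, Finset.sum_eq_single 1]
  · simp [M.act_one]
  · intro σ _ hσ
    obtain ⟨i, hi⟩ : ∃ i, σ i ≠ i := by
      by_contra! h
      exact hσ (Equiv.ext h)
    exact (M.slotAdditive_act σ m).eq_zero _ i (Sigma.ι_π_of_ne _ hi.symm)
  · simp

/-- The projector D onto the cross effect equals `gen ι ∘ retraction` on the whole module. In the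
expansion of a generator over φ, D kills the non-surjective φ. A surjective φ is a permutation, and
its term is `gen ι` of an element of M, which D fixes. -/
lemma gen_ι_retraction (x : M.Extension (∐ fun _ : Fin n => E))
    (hx : x ∈ crossEffect M.extension fun _ : Fin n => E) :
    gen (Sigma.ι fun _ : Fin n => E) (M.retraction x) = x := by
  obtain ⟨D, hD1, hD2⟩ := exists_crossEffect_projector M.extension fun _ : Fin n => E
  have hD : D = gen (M := M) (Sigma.ι fun _ : Fin n => E) ∘ₗ M.retraction :=
    extension_hom_ext fun f m => by
    rw [LinearMap.comp_apply, ← hD1 _ (M.gen_ι_mem _), retraction_gen, map_sum, map_sum,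
      (M.slotAdditive_gen _ m).expand f, map_sum]
    let s : Equiv.Perm (Fin n) ↪ (Fin n → Fin n) := ⟨fun σ => σ, DFunLike.coe_injective⟩
    rw [← Finset.sum_subset (Finset.subset_univ (Finset.univ.map s)), Finset.sum_map]
    · refine Finset.sum_congr rfl fun σ _ => ?_
      rw [gen_act]
      simp [s]
    · intro φ _ hφ
      have hsurj : ¬ Function.Surjective φ := fun h => hφ <| Finset.mem_map.2
        ⟨Equiv.ofBijective φ (Finite.surjective_iff_bijective.1 h), Finset.mem_univ _, rfl⟩
      simp only [Function.Surjective, not_forall, not_exists] at hsurj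
      obtain ⟨l, hl⟩ := hsurj
      exact hD2 l _ (M.push_gen_summands f m φ l hl)
  have := LinearMap.congr_fun hD x
  rw [hD1 x hx] at this
  exact this.symm

lemma isIso_extensionUnit : IsIso M.extensionUnit := by
  rw [isIso_iff]
  refine ⟨fun m m' h => ?_, fun x => ⟨M.retraction x.1, Subtype.ext (M.gen_ι_retraction x.1 x.2)⟩⟩
  have := congrArg M.retraction (congrArg Subtype.val h)
  exact (M.retraction_gen_ι m).symm.trans (this.trans (M.retraction_gen_ι m'))

/-! ### Universal property of the extension functor. -/

section

variable {M} {F : Pol.{max v w} C k n} (h : M ⟶ (monomialCrossEffect k E n).obj F)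

/-- The components of the morphism of functors corresponding to `h`. -/
def extensionDescApp (X : C) : M.Extension X →ₗ[k] F.obj.obj X :=
  M.extensionLift (fun f => (F.obj.map (Sigma.desc f)).hom ∘ₗ Submodule.subtype _ ∘ₗ h.lin)
    -- The bound on the degree of F makes the relations of additivity hold in F(X).
    (fun m => slotAdditive_push F.obj F.property (h.lin m).2 X)
    (fun f a σ m => (congrArg (fun y : crossEffect F.obj fun _ : Fin n => E =>
      push F.obj y.1 f) (h.map_act a σ m)).trans (push_map_monomial F.obj _ a σ f))

lemma extensionDescApp_gen {X : C} (f : Fin n → (E ⟶ X)) (m : M.carrier) :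
    extensionDescApp h X (gen f m) = push F.obj (h.lin m).1 f :=
  M.extensionLift_gen _ _ _ f m

/-- The morphism of functors corresponding to `h`. -/
def extensionDesc : M.extensionPol ⟶ F := ObjectProperty.homMk
  { app X := ModuleCat.ofHom (extensionDescApp h X)
    naturality X Y g := ModuleCat.hom_ext <| extension_hom_ext fun f m => by
      refine (congrArg (extensionDescApp h Y) (M.extensionMap_gen g f m)).trans ?_
      refine (extensionDescApp_gen h _ m).trans ?_
      refine Eq.trans ?_ (congrArg (F.obj.map g).hom (extensionDescApp_gen h f m)).symm
      exact (map_push F.obj _ f g).symm }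

end

/-- The universal property of the polynomial functor attached to `M`. -/
def extensionEquiv (F : Pol.{max v w} C k n) :
    (M.extensionPol ⟶ F) ≃ (M ⟶ (monomialCrossEffect k E n).obj F) where
  toFun α := M.extensionUnit ≫ (monomialCrossEffect k E n).map α
  invFun h := extensionDesc h
  left_inv α := by
    refine ObjectProperty.hom_ext _ (NatTrans.ext (funext fun X => ModuleCat.hom_ext <|
      extension_hom_ext fun f m => ?_))
    refine (extensionDescApp_gen _ f m).trans ?_
    refine (app_push α.hom (F := M.extension) (gen (Sigma.ι fun _ : Fin n => E) m) f).symm.trans ?_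
    rw [push_gen]
    simp
  right_inv h := hom_ext fun m => Subtype.ext <|
    (extensionDescApp_gen h _ m).trans (push_ι F.obj _)

/-- The left adjoint of the cross effect functor. -/
def extensionAdjunction (k : Type t) [CommRing k] (E : C) (n : ℕ) :
    Adjunction.leftAdjointOfEquiv (G := monomialCrossEffect.{max v w} k E n)
      (fun M F => M.extensionEquiv F) (fun _ _ _ _ _ => rfl) ⊣
    monomialCrossEffect.{max v w} k E n :=
  Adjunction.adjunctionOfEquivLeft _ _

instance (M : MonomialModule.{max v w} k E n) :
    IsIso ((extensionAdjunction.{w} k E n).unit.app M) := by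
  have : (extensionAdjunction.{w} k E n).unit.app M = M.extensionUnit :=
    MonomialModule.hom_ext fun m => rfl
  rw [this]
  exact M.isIso_extensionUnit

end MonomialModule

/-- If all the objects of `C` are finite sums of copies of `E`, then the functor
`F ↦ cr_n(F)(E, …, E)` to modules over monomial matrices exhibits its target as the quotient
`Pol_n(C) / Pol_{n-1}(C)`. -/
theorem isLocalization_monomialCrossEffect {C : Type u} [Category.{v} C] [HasFiniteCoproducts C]
    [HasZeroMorphisms C] (k : Type t) [CommRing k] {E : C} (hE : ∀ X, finiteSums E X) (n : ℕ) :
    (monomialCrossEffect.{max v w} k E n).IsLocalization (polIso.{max v w} C k n) := by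
  rw [polIso_eq hE]
  have : IsIso (MonomialModule.extensionAdjunction.{w} k E n).unit :=
    NatIso.isIso_of_isIso_app _
  have := (MonomialModule.extensionAdjunction.{w} k E n).fullyFaithfulLOfIsIsoUnit
  have := this.full
  have := (MonomialModule.extensionAdjunction.{w} k E n).fullyFaithfulLOfIsIsoUnit.faithful
  -- A right adjoint whose left adjoint is fully faithful is a localization at the morphisms it
  -- inverts.
  exact (MonomialModule.extensionAdjunction.{w} k E n).isLocalization'

section Comparison

variable {C : Type u} [Category.{v} C] [HasFiniteCoproducts C] [HasZeroMorphisms C]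
variable {D : Type u'} [Category.{v'} D] [HasFiniteCoproducts D] [HasZeroMorphisms D]
variable (Ψ : C ⥤ D) [PreservesFiniteCoproducts Ψ] {k : Type t} [CommRing k]

/-! ### Comparison along functors which preserve finite coproducts -/

/-- In the presence of zero morphisms an initial object is a zero object, and the initial object is
the empty coproduct. -/
lemma preservesZeroMorphisms_of_preservesFiniteCoproducts : Ψ.PreservesZeroMorphisms :=
  have := hasZeroObject_of_hasInitial_object (C := C)
  have := hasZeroObject_of_hasInitial_object (C := D)
  inferInstance

/-- Matches the additivity test morphisms E ⟶ E ⨿ E in C with those of Ψ(E) in D. -/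
lemma map_coprodDesc_comparison {A B Z : C} {X : D} (g : X ⟶ Ψ.obj A ⨿ Ψ.obj B) (p : A ⟶ Z)
    (q : B ⟶ Z) :
    (g ≫ coprodComparison Ψ A B) ≫ Ψ.map (coprod.desc p q) =
      g ≫ coprod.desc (Ψ.map p) (Ψ.map q) := by
  rw [Category.assoc]
  congr 1
  ext <;> simp [← Ψ.map_comp, coprod.inl_desc, coprod.inr_desc]

section

variable (G : D ⥤ ModuleCat.{w} k) {n : ℕ} (X : Fin n → C)

/-- The identification of `G(Φ(X₁) + ⋯ + Φ(Xₙ))` with `G(Φ(X₁ + ⋯ + Xₙ))`. -/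
def comparisonEquiv : G.obj (∐ fun i => Ψ.obj (X i)) ≃ₗ[k] (Ψ ⋙ G).obj (∐ X) :=
  (G.mapIso (asIso (sigmaComparison Ψ X))).toLinearEquiv

variable {X}

lemma push_comparisonEquiv (y : G.obj (∐ fun i => Ψ.obj (X i))) {Y : C} (f : ∀ i, X i ⟶ Y) :
    push (Ψ ⋙ G) (comparisonEquiv Ψ G X y) f = push G y fun i => Ψ.map (f i) := by
  have : (Sigma.desc fun i => Ψ.map (f i)) = sigmaComparison Ψ X ≫ Ψ.map (Sigma.desc f) :=
    Sigma.hom_ext _ _ fun i => by simp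
  rw [push, push, this, G.map_comp]
  rfl

lemma comparisonEquiv_push {m : ℕ} {Z : Fin m → C} (y : G.obj (∐ fun i => Ψ.obj (Z i)))
    (f : ∀ i, Ψ.obj (Z i) ⟶ ∐ fun i => Ψ.obj (X i)) :
    comparisonEquiv Ψ G X (push G y f) = push G y fun i => f i ≫ sigmaComparison Ψ X :=
  map_push G y f _

lemma comparisonEquiv_mem_iff (y : G.obj (∐ fun i => Ψ.obj (X i))) :
    comparisonEquiv Ψ G X y ∈ crossEffect (Ψ ⋙ G) X ↔
      y ∈ crossEffect G fun i => Ψ.obj (X i) := by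
  have := preservesZeroMorphisms_of_preservesFiniteCoproducts Ψ
  rw [mem_crossEffect_iff, mem_crossEffect_iff]
  refine forall_congr' fun i => ?_
  rw [← (comparisonEquiv Ψ G X).map_eq_zero_iff, comparisonEquiv_push, push_comparisonEquiv]
  have : (fun j => Ψ.map (Function.update (Sigma.ι X) i 0 j)) = fun j =>
      Function.update (Sigma.ι fun i => Ψ.obj (X i)) i 0 j ≫ sigmaComparison Ψ X := by
    funext j
    by_cases hj : j = i
    · subst hj; simp
    · simp [hj]
  rw [this]

lemma degreeLT_comp (hG : DegreeLT.{w} D k (n + 1) G) : DegreeLT.{w} C k (n + 1) (Ψ ⋙ G) := by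
  intro X
  refine (Submodule.eq_bot_iff _).2 fun x hx => ?_
  obtain ⟨y, rfl⟩ := (comparisonEquiv Ψ G X).surjective x
  rw [comparisonEquiv_mem_iff, hG, Submodule.mem_bot] at hx
  rw [hx, map_zero]

end

variable (k) in
/-- The functor `Pol_n(D) ⥤ Pol_n(C)` given by precomposition. -/
abbrev precompPol (n : ℕ) : Pol.{w} D k n ⥤ Pol.{w} C k n :=
  (DegreeLT.{w} C k (n + 1)).lift
    ((DegreeLT.{w} D k (n + 1)).ι ⋙ (Functor.whiskeringLeft C D (ModuleCat.{w} k)).obj Ψ)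
    (fun G => degreeLT_comp Ψ G.obj G.property)

variable (k) in
/-- Restriction of modules over monomial matrices along `Φ`. -/
abbrev restrictMonomial (E : C) (n : ℕ) :
    MonomialModule.{w} k (Ψ.obj E) n ⥤ MonomialModule.{w} k E n where
  obj M :=
    { carrier := M.carrier
      act a σ := M.act (fun i => Ψ.map (a i)) σ
      act_one m := by simpa using M.act_one m
      act_act a b σ τ m := by simpa using M.act_act _ _ σ τ m
      slotAdditive_act σ m a i g := by
        have := preservesZeroMorphisms_of_preservesFiniteCoproducts Ψ
        have key (r : E ⟶ E) : (fun j => Ψ.map (Function.update a i r j)) =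
            Function.update (fun j => Ψ.map (a j)) i (Ψ.map r) := by
          funext j
          by_cases hj : j = i
          · subst hj; simp
          · simp [hj]
        have h := M.slotAdditive_act σ m (fun j => Ψ.map (a j)) i
          (Ψ.map g ≫ inv (coprodComparison Ψ E E))
        have h2 (p q : E ⟶ E) :
            (Ψ.map g ≫ inv (coprodComparison Ψ E E)) ≫ coprod.desc (Ψ.map p) (Ψ.map q) =
              Ψ.map (g ≫ coprod.desc p q) := by
          rw [← map_coprodDesc_comparison]
          simp
        simp only [key]
        simpa only [← h2, Ψ.map_id, Ψ.map_zero] using h }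
  map f := ⟨f.lin, fun a σ m => f.map_act _ σ m⟩

/-! ### Restriction of monomial modules along Ψ is an equivalence. -/

section

variable (E : C) (n : ℕ)

instance : (restrictMonomial.{w} Ψ k E n).Faithful where
  map_injective {M N} _ _ h := MonomialModule.hom_ext fun m =>
    congrArg (fun f : (restrictMonomial.{w} Ψ k E n).obj M ⟶
      (restrictMonomial.{w} Ψ k E n).obj N => f.lin m) h

variable {E}

lemma full_restrictMonomial (hΨ : Function.Bijective fun f : E ⟶ E => Ψ.map f) :
    (restrictMonomial.{w} Ψ k E n).Full where
  map_surjective {M N} f := by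
    refine ⟨⟨f.lin, fun b σ m => ?_⟩, rfl⟩
    choose a ha using fun i => hΨ.2 (b i)
    obtain rfl : (fun i => Ψ.map (a i)) = b := funext ha
    exact f.map_act a σ m

lemma essSurj_restrictMonomial [Ψ.Full] (hΨ : Function.Bijective fun f : E ⟶ E => Ψ.map f) :
    (restrictMonomial.{w} Ψ k E n).EssSurj where
  mem_essImage N := by
    have := preservesZeroMorphisms_of_preservesFiniteCoproducts Ψ
    let e : (E ⟶ E) ≃ (Ψ.obj E ⟶ Ψ.obj E) := Equiv.ofBijective _ hΨ
    have he (a : E ⟶ E) : e.symm (Ψ.map a) = a := e.symm_apply_apply a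
    have he' (b : Ψ.obj E ⟶ Ψ.obj E) : Ψ.map (e.symm b) = b := e.apply_symm_apply b
    let M : MonomialModule.{w} k (Ψ.obj E) n :=
      { carrier := N.carrier
        act b σ := N.act (fun i => e.symm (b i)) σ
        act_one m := by
          simp only [← Ψ.map_id, he]
          exact N.act_one m
        act_act a b σ τ m := by
          rw [N.act_act]
          congr 2
          funext i
          apply e.injective
          change Ψ.map _ = e (e.symm _)
          rw [e.apply_symm_apply, Ψ.map_comp, he', he']
        slotAdditive_act σ m b i g := by
          -- Fullness lifts the test morphism g to C. The choice of lift is harmless, since only its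
          -- composites into E matter and these are determined by bijectivity on End(E).
          obtain ⟨g', hg'⟩ := Ψ.map_surjective (g ≫ coprodComparison Ψ E E)
          have key (r : Ψ.obj E ⟶ Ψ.obj E) : (fun j => e.symm (Function.update b i r j)) =
              Function.update (fun j => e.symm (b j)) i (e.symm r) := by
            funext j
            by_cases hj : j = i
            · subst hj; simp
            · simp [hj]
          have h2 (p q : E ⟶ E) : e.symm (g ≫ coprod.desc (Ψ.map p) (Ψ.map q)) =
              g' ≫ coprod.desc p q := by
            rw [← map_coprodDesc_comparison, ← hg', ← Ψ.map_comp, he]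
          simp only [key]
          have h := N.slotAdditive_act σ m (fun j => e.symm (b j)) i g'
          simpa only [← h2, Ψ.map_id, Ψ.map_zero] using h }
    refine ⟨M, ⟨MonomialModule.isoMk (LinearEquiv.refl k N.carrier) fun a σ m => ?_⟩⟩
    change N.act (fun i => e.symm (Ψ.map (a i))) σ m = N.act a σ m
    simp only [he]

end

/-- The cross effects of `Φ ⋙ G` at `E` are those of `G` at `Φ(E)`. -/
def monomialCrossEffectComparison (k : Type t) [CommRing k] (E : C) (n : ℕ) :
    monomialCrossEffect.{w} k (Ψ.obj E) n ⋙ restrictMonomial.{w} Ψ k E n ≅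
      precompPol.{w} Ψ k n ⋙ monomialCrossEffect.{w} k E n :=
  NatIso.ofComponents
    (fun G => MonomialModule.isoMk
      (LinearEquiv.ofSubmodules (comparisonEquiv Ψ G.obj fun _ : Fin n => E) _ _ <| by
        ext x
        rw [Submodule.mem_map_equiv, ← comparisonEquiv_mem_iff, LinearEquiv.apply_symm_apply]
        rfl)
      (fun a σ (y : crossEffect G.obj fun _ : Fin n => Ψ.obj E) => Subtype.ext <| by
        refine (comparisonEquiv_push Ψ G.obj y.1 _).trans
          (Eq.trans ?_ (push_comparisonEquiv Ψ G.obj y.1 _).symm)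
        congr 1
        funext i
        simp))
    (fun {G H} α => MonomialModule.hom_ext
      fun (y : crossEffect G.obj fun _ : Fin n => Ψ.obj E) => Subtype.ext <|
        (LinearMap.congr_fun (congrArg ModuleCat.Hom.hom
          (α.hom.naturality (sigmaComparison Ψ fun _ : Fin n => E))) y.1).symm)

variable {Ψ} in
/-- The criterion for a functor `C ⥤ D` to induce an equivalence
`Pol_n(D) / Pol_{n-1}(D) ≌ Pol_n(C) / Pol_{n-1}(C)`. -/
theorem inducesPolQuotEquivalence [Ψ.Full] {E : C}
    (hΨ : Function.Bijective fun f : E ⟶ E => Ψ.map f) (hC : ∀ X, finiteSums E X)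
    (hD : ∀ Y, finiteSums (Ψ.obj E) Y) (n : ℕ) :
    InducesPolQuotEquivalence.{max v v' w} k Ψ n := by
  refine ⟨fun G hG => degreeLT_comp Ψ G hG, ?_⟩
  have := full_restrictMonomial.{max v v' w} (k := k) Ψ n hΨ
  have := essSurj_restrictMonomial.{max v v' w} (k := k) Ψ n hΨ
  have : (restrictMonomial.{max v v' w} Ψ k E n).IsEquivalence := {}
  have hlC := isLocalization_monomialCrossEffect.{max v' w} k hC n
  have hlD := isLocalization_monomialCrossEffect.{max v w} k hD n
  -- The cross effect at Ψ(E) followed by the equivalence `restrictMonomial` localizes Pol_n(D). It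
  -- agrees with precomposition by Ψ followed by the cross effect at E.
  have h1 : (precompPol.{max v v' w} Ψ k n ⋙ monomialCrossEffect k E n).IsLocalization
      (polIso.{max v v' w} D k n) :=
    Functor.IsLocalization.of_iso _ (monomialCrossEffectComparison Ψ k E n)
  -- The cross effect at E and the projection to the quotient both localize Pol_n(C), so one may
  -- replace the other as the second factor.
  have h2 : (precompPol.{max v v' w} Ψ k n ⋙ polProj.{max v v' w} C k n).IsLocalization
      (polIso.{max v v' w} D k n) :=
    Functor.IsLocalization.of_equivalence_target
      (precompPol.{max v v' w} Ψ k n ⋙ monomialCrossEffect k E n) _ _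
      (Localization.uniq (monomialCrossEffect k E n) (polProj.{max v v' w} C k n)
        (polIso.{max v v' w} C k n))
      (Functor.associator _ _ _ ≪≫ Functor.isoWhiskerLeft _ (Localization.compUniqFunctor _ _ _))
  exact ⟨Localization.uniq (polProj.{max v v' w} D k n)
    (precompPol.{max v v' w} Ψ k n ⋙ polProj.{max v v' w} C k n) (polIso.{max v v' w} D k n),
    ⟨Localization.compUniqFunctor _ _ _⟩⟩

end Comparison

/-! ### The subcategory generated by an object, and the algebra `Λ` -/

/-- The inclusion of a full subcategory reflects colimits, so preservation can be checked after
composing with it. -/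
lemma preservesFiniteCoproducts_lift {C : Type u} [Category.{v} C] [HasFiniteCoproducts C]
    {D : Type u'} [Category.{v'} D] [HasFiniteCoproducts D] (P : ObjectProperty D)
    [∀ m : ℕ, P.IsClosedUnderColimitsOfShape (Discrete (Fin m))] (F : C ⥤ D)
    [PreservesFiniteCoproducts F] (hF : ∀ X, P (F.obj X)) :
    PreservesFiniteCoproducts (P.lift F hF) where
  preserves m := by
    have : PreservesColimitsOfShape (Discrete (Fin m)) (P.lift F hF ⋙ P.ι) :=
      inferInstanceAs (PreservesColimitsOfShape (Discrete (Fin m)) F)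
    exact preservesColimitsOfShape_of_reflects_of_preserves _ P.ι

lemma preservesFiniteCoproducts_ι {C : Type u} [Category.{v} C] [HasFiniteCoproducts C]
    (P : ObjectProperty C) [∀ m : ℕ, P.IsClosedUnderColimitsOfShape (Discrete (Fin m))] :
    PreservesFiniteCoproducts P.ι where
  preserves _ := inferInstance

section Span

variable {C : Type u} [Category.{v} C] [HasFiniteCoproducts C]
variable {D : Type u'} [Category.{v'} D] [HasFiniteCoproducts D]

lemma finiteSums_self (E : C) : finiteSums E E := by
  let X : Fin 1 → C := fun _ => E
  exact ⟨1, ⟨⟨Sigma.ι X 0, Sigma.desc fun _ => 𝟙 E, Sigma.ι_desc _ _, Sigma.hom_ext _ _ fun i => by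
    obtain rfl : i = 0 := Subsingleton.elim _ _
    simp [X]⟩⟩⟩

lemma finiteSums_span {E : C} (hE : finiteSums E E) (X : Span E) :
    finiteSums (⟨E, hE⟩ : Span E) X := by
  have := preservesFiniteCoproducts_ι (finiteSums E)
  obtain ⟨n, ⟨e⟩⟩ := X.property
  exact ⟨n, ⟨(finiteSums E).ι.preimageIso
    (e ≪≫ (PreservesCoproduct.iso (finiteSums E).ι fun _ : Fin n => (⟨E, hE⟩ : Span E)).symm)⟩⟩

lemma preservesFiniteCoproducts_spanFunctor (Φ : C ⥤ D) [PreservesFiniteCoproducts Φ] (E : C) :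
    PreservesFiniteCoproducts (spanFunctor Φ E) := by
  have := preservesFiniteCoproducts_ι (finiteSums E)
  have : PreservesFiniteCoproducts ((finiteSums E).ι ⋙ Φ) := ⟨fun _ => inferInstance⟩
  exact preservesFiniteCoproducts_lift _ _ _

variable [HasZeroMorphisms C] [HasZeroMorphisms D]

lemma inducesPolQuotEquivalence_spanFunctor (k : Type t) [CommRing k] (Φ : C ⥤ D)
    [PreservesFiniteCoproducts Φ] [Φ.Full] (E : C)
    (hΦ : Function.Bijective fun f : E ⟶ E => Φ.map f) (n : ℕ) :
    InducesPolQuotEquivalence.{max v v' w} k (spanFunctor Φ E) n := by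
  have := preservesFiniteCoproducts_spanFunctor Φ E
  have : (spanFunctor Φ E).Full :=
    ⟨fun {X Y} f => by
      obtain ⟨g, hg⟩ := Φ.map_surjective f.hom
      exact ⟨ObjectProperty.homMk g, ObjectProperty.hom_ext _ hg⟩⟩
  refine inducesPolQuotEquivalence.{w} (E := (⟨E, finiteSums_self E⟩ : Span E))
    ⟨fun f g h => ?_, fun f => ?_⟩
    (finiteSums_span _) (fun Y => finiteSums_span _ Y) n
  · exact ObjectProperty.hom_ext _ (hΦ.1 (congrArg (fun q => q.hom) h))
  · obtain ⟨g, hg⟩ := hΦ.2 f.hom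
    exact ⟨ObjectProperty.homMk g, ObjectProperty.hom_ext _ hg⟩

lemma mem_lambdaIdeal_iff {k : Type t} [CommRing k] {E : C} {x : MonoidAlgebra k (End E)} :
    x ∈ lambdaIdeal k E ↔ ∃ y, lambdaRel k E y = x :=
  Iff.rfl

/-- The isomorphism of monoid algebras matches the two ideals. Relations of C go to relations of D
by inverting the coproduct comparison (`h1`), and every relation of D arises in this way because Φ
is full (`h2`). -/
lemma exists_lambda_algEquiv (k : Type t) [CommRing k] (Φ : C ⥤ D)
    [PreservesFiniteCoproducts Φ] [Φ.Full] (E : C)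
    (hΦ : Function.Bijective fun f : E ⟶ E => Φ.map f) :
    ∃ φ : Lambda k E ≃ₐ[k] Lambda k (Φ.obj E),
      ∀ f : E ⟶ E, φ (Lambda.mk k E f) = Lambda.mk k (Φ.obj E) (Φ.map f) := by
  have := preservesZeroMorphisms_of_preservesFiniteCoproducts Φ
  let e : End E ≃* End (Φ.obj E) :=
    { Equiv.ofBijective _ hΦ with map_mul' := fun f g => Φ.map_comp g f }
  let ψ : MonoidAlgebra k (End E) ≃ₐ[k] MonoidAlgebra k (End (Φ.obj E)) :=
    MonoidAlgebra.domCongr k k e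
  have hψ (f : End E) : ψ (MonoidAlgebra.of k _ f) =
      MonoidAlgebra.of k (End (Φ.obj E)) (Φ.map f) := by
    simp only [ψ, MonoidAlgebra.of_apply, MonoidAlgebra.domCongr_single]
    rfl
  have hrel (f : E ⟶ E ⨿ E) (g : Φ.obj E ⟶ Φ.obj E ⨿ Φ.obj E)
      (h : Φ.map f = g ≫ coprodComparison Φ E E) (r : k) :
      ψ (lambdaRel k E (Finsupp.single f r)) = lambdaRel k (Φ.obj E) (Finsupp.single g r) := by
    have key (p q : E ⟶ E) : Φ.map (f ≫ coprod.desc p q) =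
        g ≫ coprod.desc (Φ.map p) (Φ.map q) := by
      rw [← map_coprodDesc_comparison, ← h, Φ.map_comp]
    simp only [lambdaRel, Finsupp.linearCombination_single, map_smul, map_add, map_sub, hψ, key,
      Φ.map_id, Φ.map_zero]
  have h1 (y : (E ⟶ E ⨿ E) →₀ k) : ∃ z, ψ (lambdaRel k E y) = lambdaRel k (Φ.obj E) z := by
    induction y using Finsupp.induction_linear with
    | zero => exact ⟨0, by simp⟩
    | add a b ha hb =>
      obtain ⟨a', ha⟩ := ha
      obtain ⟨b', hb⟩ := hb
      exact ⟨a' + b', by rw [map_add, map_add, ha, hb, map_add]⟩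
    | single f r =>
      exact ⟨Finsupp.single (Φ.map f ≫ inv (coprodComparison Φ E E)) r, hrel f _ (by simp) r⟩
  have h2 (z : (Φ.obj E ⟶ Φ.obj E ⨿ Φ.obj E) →₀ k) :
      ∃ y, ψ (lambdaRel k E y) = lambdaRel k (Φ.obj E) z := by
    induction z using Finsupp.induction_linear with
    | zero => exact ⟨0, by simp⟩
    | add a b ha hb =>
      obtain ⟨a', ha⟩ := ha
      obtain ⟨b', hb⟩ := hb
      exact ⟨a' + b', by rw [map_add, map_add, ha, hb, map_add]⟩
    | single g r =>
      obtain ⟨f, hf⟩ := Φ.map_surjective (g ≫ coprodComparison Φ E E)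
      exact ⟨Finsupp.single f r, hrel f g hf r⟩
  let ψ' : MonoidAlgebra k (End E) →+* MonoidAlgebra k (End (Φ.obj E)) := ψ
  have hideal : lambdaIdeal k (Φ.obj E) = (lambdaIdeal k E).map ψ' := by
    refine le_antisymm (fun x hx => ?_) (Ideal.map_le_iff_le_comap.2 fun x hx => ?_)
    · obtain ⟨z, rfl⟩ := mem_lambdaIdeal_iff.1 hx
      obtain ⟨y, hy⟩ := h2 z
      have hm : lambdaRel k E y ∈ lambdaIdeal k E := mem_lambdaIdeal_iff.2 ⟨y, rfl⟩
      have := Ideal.mem_map_of_mem ψ' hm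
      rwa [show ψ' (lambdaRel k E y) = _ from hy] at this
    · obtain ⟨y, rfl⟩ := mem_lambdaIdeal_iff.1 hx
      obtain ⟨z, hz⟩ := h1 y
      exact mem_lambdaIdeal_iff.2 ⟨z, hz.symm⟩
  exact ⟨Ideal.quotientEquivAlg _ _ ψ hideal, fun f =>
    congrArg (Ideal.Quotient.mk (lambdaIdeal k (Φ.obj E))) (hψ f)⟩

end Span

/-! ### Free groups and free abelian groups -/

lemma finiteSums_of_iso {C : Type u} [Category.{v} C] [HasFiniteCoproducts C] {E E' : C}
    (e : E ≅ E') {X : C} (h : finiteSums E X) : finiteSums E' X :=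
  h.imp fun _ ⟨f⟩ => ⟨f ≪≫ Sigma.mapIso fun _ => e⟩

/-- The free group on one generator as an object of `gr`. -/
def Gr.free : Gr := ⟨GrpCat.of (FreeGroup Unit), inferInstanceAs (IsFreeGroup (FreeGroup Unit)),
  inferInstanceAs (Group.FG (FreeGroup Unit))⟩

/-- The abelianization is a finitely generated ℤ-module with the generators as a basis, and such a
basis is finite. -/
lemma finite_generators (G : Type) [Group G] [IsFreeGroup G] [Group.FG G] :
    Finite (IsFreeGroup.Generators G) := by
  have : Group.FG (Abelianization G) :=
    Group.fg_of_surjective (f := Abelianization.of) Quotient.mk_surjective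
  have : Module.Finite ℤ (Additive (Abelianization G)) :=
    Module.Finite.iff_addGroup_fg.2 inferInstance
  let e : FreeAbelianGroup (IsFreeGroup.Generators G) ≃+ Additive (Abelianization G) :=
    MulEquiv.toAdditive (IsFreeGroup.toFreeGroup G).symm.abelianizationCongr
  have : Module.Finite ℤ (IsFreeGroup.Generators G →₀ ℤ) :=
    Module.Finite.equiv ((FreeAbelianGroup.equivFinsupp _).symm.trans e).symm.toIntLinearEquiv
  exact Module.Finite.finite_basis (Finsupp.basisSingleOne (R := ℤ))

lemma Gr.finiteSums_free (X : Gr) : finiteSums Gr.free X := by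
  have := X.property.1
  have := X.property.2
  have := finite_generators X.obj
  obtain ⟨n, ⟨e⟩⟩ := Finite.exists_equiv_fin (IsFreeGroup.Generators X.obj)
  let b : FreeGroupBasis (Fin n) X.obj := (IsFreeGroup.basis X.obj).reindex e
  let c (i : Fin n) : Gr.free ⟶ ∐ fun _ : Fin n => Gr.free := Sigma.ι (fun _ : Fin n => Gr.free) i
  let p : X ⟶ ∐ fun _ : Fin n => Gr.free := ObjectProperty.homMk
    (GrpCat.ofHom (b.lift fun i => (c i).hom.hom (FreeGroup.of ())))
  let d (i : Fin n) : Gr.free ⟶ X := ObjectProperty.homMk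
    (GrpCat.ofHom (FreeGroup.lift fun _ => b i))
  let q : (∐ fun _ : Fin n => Gr.free) ⟶ X := Sigma.desc d
  have hd (i : Fin n) : c i ≫ q = d i := Sigma.ι_desc _ _
  have hp (i : Fin n) : p.hom.hom (b i) = (c i).hom.hom (FreeGroup.of ()) :=
    congrFun (b.lift.symm_apply_apply _) i
  refine ⟨n, ⟨⟨p, q, ?_, ?_⟩⟩⟩
  · apply ObjectProperty.hom_ext
    apply GrpCat.hom_ext
    refine b.ext_hom _ _ fun i => ?_
    change q.hom.hom (p.hom.hom (b i)) = b i
    rw [hp]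
    change (c i ≫ q).hom.hom (FreeGroup.of ()) = b i
    rw [hd]
    exact FreeGroup.lift_apply_of
  · refine Sigma.hom_ext _ _ fun i => ?_
    change c i ≫ q ≫ p = c i ≫ 𝟙 _
    rw [Category.comp_id, ← Category.assoc, hd]
    apply ObjectProperty.hom_ext
    apply GrpCat.hom_ext
    refine FreeGroup.ext_hom _ _ fun _ => ?_
    change p.hom.hom (FreeGroup.lift (fun _ => b i) (FreeGroup.of ())) = _
    rw [FreeGroup.lift_apply_of]
    exact hp i

lemma Ab.finiteSums_int (Y : Ab) : finiteSums Ab.int Y := by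
  have := Y.property.1
  have := Y.property.2
  let b := Module.finBasis ℤ Y.obj
  set n := Module.finrank ℤ Y.obj
  let c (i : Fin n) : Ab.int ⟶ ∐ fun _ : Fin n => Ab.int := Sigma.ι (fun _ : Fin n => Ab.int) i
  let p : Y ⟶ ∐ fun _ : Fin n => Ab.int := ObjectProperty.homMk
    (AddCommGrpCat.ofHom (b.constr ℤ fun i => (c i).hom.hom (1 : ℤ)).toAddMonoidHom)
  let d (i : Fin n) : Ab.int ⟶ Y := ObjectProperty.homMk
    (AddCommGrpCat.ofHom (zmultiplesHom _ (b i)))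
  let q : (∐ fun _ : Fin n => Ab.int) ⟶ Y := Sigma.desc d
  have hd (i : Fin n) : c i ≫ q = d i := Sigma.ι_desc _ _
  have hp (i : Fin n) : p.hom.hom (b i) = (c i).hom.hom (1 : ℤ) := b.constr_basis ℤ _ i
  have hd1 (i : Fin n) : (d i).hom.hom (1 : ℤ) = b i := one_zsmul _
  refine ⟨n, ⟨⟨p, q, ?_, ?_⟩⟩⟩
  · apply ObjectProperty.hom_ext
    apply AddCommGrpCat.hom_ext
    apply AddMonoidHom.toIntLinearMap_injective
    refine b.ext fun i => ?_
    change q.hom.hom (p.hom.hom (b i)) = b i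
    rw [hp]
    change (c i ≫ q).hom.hom (1 : ℤ) = b i
    rw [hd, hd1]
  · refine Sigma.hom_ext _ _ fun i => ?_
    change c i ≫ q ≫ p = c i ≫ 𝟙 _
    rw [Category.comp_id, ← Category.assoc, hd]
    apply ObjectProperty.hom_ext
    apply AddCommGrpCat.hom_ext
    refine AddMonoidHom.ext_int ?_
    change p.hom.hom ((d i).hom.hom (1 : ℤ)) = _
    rw [hd1]
    exact hp i

/-- The abelianization of the free group on one generator is `ℤ`. -/
def Ab.intIso : Ab.int ≅ abelianization.obj Gr.free :=
  isFreeAbFG.isoMk (X := Ab.int) (Y := abelianization.obj Gr.free)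
    (AddEquiv.toAddCommGrpIso (FreeAbelianGroup.uniqueEquiv Unit).symm)

instance : PreservesFiniteCoproducts abelianization := by
  have := preservesFiniteCoproducts_ι isFreeFG
  have : GrpCat.abelianize.{0}.IsLeftAdjoint := GrpCat.abelianizeAdj.isLeftAdjoint
  have : CommGrpCat.toAddCommGrp.{0}.IsEquivalence :=
    inferInstanceAs commGroupAddCommGroupEquivalence.functor.IsEquivalence
  have : PreservesFiniteCoproducts
      (isFreeFG.ι ⋙ GrpCat.abelianize ⋙ CommGrpCat.toAddCommGrp) := ⟨fun _ => inferInstance⟩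
  exact preservesFiniteCoproducts_lift isFreeAbFG _ _

/-- A homomorphism of abelianizations lifts: on free generators of G, choose preimages under the
surjection from H to its abelianization. -/
instance : abelianization.Full where
  map_surjective {G H} g := by
    have : IsFreeGroup G.obj := G.property.1
    let g' : G.obj →* Abelianization H.obj :=
      (AddMonoidHom.toMultiplicativeRight (α := Abelianization G.obj)
        (β := Additive (Abelianization H.obj)) g.hom.hom).comp Abelianization.of
    have hsurj (i : IsFreeGroup.Generators G.obj) : ∃ y : H.obj,
        Abelianization.of y = g' (IsFreeGroup.of i) :=
      Quotient.mk_surjective _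
    choose y hy using hsurj
    have key : Abelianization.of.comp (IsFreeGroup.lift y) = g' :=
      IsFreeGroup.ext_hom fun i => by
        rw [← hy i, MonoidHom.comp_apply, IsFreeGroup.lift_of]
    refine ⟨ObjectProperty.homMk (GrpCat.ofHom (IsFreeGroup.lift y)), ?_⟩
    apply ObjectProperty.hom_ext
    apply AddCommGrpCat.hom_ext
    refine AddMonoidHom.ext fun z => ?_
    obtain ⟨x, rfl⟩ : ∃ x : G.obj, Additive.ofMul (Abelianization.of x) = z :=
      Quotient.mk_surjective z
    exact congrArg Additive.ofMul (DFunLike.congr_fun key x)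

/-- The free group on one generator is cyclic, hence commutative, so its identity map factors
through the abelianization. -/
lemma abelianization_of_injective :
    Function.Injective (Abelianization.of (G := FreeGroup Unit)) := by
  let _ : CommGroup (FreeGroup Unit) := IsCyclic.commGroup
  intro x y h
  have := congrArg (Abelianization.lift (MonoidHom.id (FreeGroup Unit))) h
  simpa using this

lemma abelianization_map_bijective :
    Function.Bijective fun f : Gr.free ⟶ Gr.free => abelianization.map f := by
  refine ⟨fun f f' h => ?_, abelianization.map_surjective⟩
  apply ObjectProperty.hom_ext
  apply GrpCat.hom_ext
  refine MonoidHom.ext fun x => abelianization_of_injective ?_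
  exact congrArg (fun g : abelianization.obj Gr.free ⟶ abelianization.obj Gr.free =>
    g.hom.hom (Additive.ofMul (Abelianization.of x))) h

lemma inducesPolQuotEquivalence_abelianization (k : Type t) [CommRing k] (n : ℕ) :
    InducesPolQuotEquivalence.{t} k abelianization n :=
  inducesPolQuotEquivalence.{t} abelianization_map_bijective Gr.finiteSums_free
    (fun Y => finiteSums_of_iso Ab.intIso (Ab.finiteSums_int Y)) n

/-! ### Restriction of modules over monomial matrices to the symmetric group -/

section

variable {C : Type u} [Category.{v} C] [HasFiniteCoproducts C] [HasZeroMorphisms C]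

/-- The representation of the symmetric group underlying a module over monomial matrices. -/
abbrev MonomialModule.rep {k : Type t} [CommRing k] {E : C} {n : ℕ} (M : MonomialModule.{w} k E n) :
    Representation k (Equiv.Perm (Fin n)) M.carrier where
  toFun σ := M.act (fun _ => 𝟙 E) σ
  map_one' := LinearMap.ext M.act_one
  map_mul' σ τ := LinearMap.ext fun m => by simp [M.act_act]

/-- The functor which restricts the action of the monomial matrices to the symmetric group. -/
abbrev monomialForget (k : Type t) [CommRing k] (E : C) (n : ℕ) :
    MonomialModule.{w} k E n ⥤ Rep.{w} k (Equiv.Perm (Fin n)) where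
  obj M := Rep.of M.rep
  map {M N} f := Rep.ofHom (ρ := M.rep) (σ := N.rep)
    { f.lin with isIntertwining' := fun σ => LinearMap.ext fun m => f.map_act _ σ m }

/-- The functor `F ↦ cr_n(F)(E, …, E)` to representations factors through modules over monomial
matrices. -/
def monomialCrossEffectForget (k : Type t) [CommRing k] (E : C) (n : ℕ) :
    monomialCrossEffect.{w} k E n ⋙ monomialForget.{w} k E n ≅
      (DegreeLT.{w} C k (n + 1)).ι ⋙ crossEffectRepFunctor.{w} k E n :=
  NatIso.ofComponents
    (fun F => Rep.mkIso (Representation.Equiv.mk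
      (LinearEquiv.refl k (crossEffect F.obj fun _ : Fin n => E)) fun σ => LinearMap.ext
        fun y => Subtype.ext (by
          have : monomial (fun _ => 𝟙 E) σ = permMap E σ :=
            Sigma.hom_ext _ _ fun i => by simp [monomial, permMap]
          change (F.obj.map (monomial (fun _ => 𝟙 E) σ)).hom y.1 = (F.obj.map (permMap E σ)).hom y.1
          rw [this])))
    (fun {F G} α => rfl)

end

/-! ### Modules over monomial matrices of integers -/

/-- The integer corresponding to an endomorphism of `ℤ`. -/
def Ab.deg (a : Ab.int ⟶ Ab.int) : ℤ := a.hom.hom (1 : ℤ)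

/-- The morphism from `ℤ` which corresponds to an element. -/
def Ab.ofElt {Y : Ab} (y : Y.obj) : Ab.int ⟶ Y :=
  ObjectProperty.homMk (AddCommGrpCat.ofHom (zmultiplesHom _ y))

lemma Ab.ofElt_one {Y : Ab} (y : Y.obj) : (Ab.ofElt y).hom.hom (1 : ℤ) = y := one_zsmul _

lemma Ab.int_hom_ext {Y : Ab} {a b : Ab.int ⟶ Y} (h : a.hom.hom (1 : ℤ) = b.hom.hom (1 : ℤ)) :
    a = b :=
  ObjectProperty.hom_ext _ (AddCommGrpCat.hom_ext (AddMonoidHom.ext_int h))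

lemma Ab.deg_comp (a b : Ab.int ⟶ Ab.int) : Ab.deg (a ≫ b) = Ab.deg a * Ab.deg b := by
  have h1 : Ab.deg a • (1 : ℤ) = Ab.deg a := by simp
  have h2 : b.hom.hom (Ab.deg a • (1 : ℤ)) = Ab.deg a • b.hom.hom (1 : ℤ) := map_zsmul b.hom.hom _ _
  rw [h1] at h2
  exact h2.trans (smul_eq_mul (α := ℤ) (Ab.deg a) (Ab.deg b))

/-- Multiplication by an integer. -/
def Ab.ofInt (z : ℤ) : Ab.int ⟶ Ab.int := Ab.ofElt (Y := Ab.int) z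

lemma Ab.deg_ofInt (z : ℤ) : Ab.deg (Ab.ofInt z) = z := Ab.ofElt_one (Y := Ab.int) z

lemma Ab.ofInt_deg (a : Ab.int ⟶ Ab.int) : Ab.ofInt (Ab.deg a) = a :=
  Ab.int_hom_ext (Ab.deg_ofInt _)

lemma Ab.deg_id : Ab.deg (𝟙 Ab.int) = 1 := rfl

/-- In ab the pointwise sum of the two projections is again a morphism, and it agrees with the fold
map on both summands. Slot-additivity over ℤ is thus ordinary additivity in the integer entries. -/
lemma Ab.coprod_desc_add (x : (Ab.int ⨿ Ab.int : Ab).obj) :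
    (coprod.desc (𝟙 Ab.int) 0 : Ab.int ⨿ Ab.int ⟶ Ab.int).hom.hom x +
      (coprod.desc 0 (𝟙 Ab.int) : Ab.int ⨿ Ab.int ⟶ Ab.int).hom.hom x =
    (coprod.desc (𝟙 Ab.int) (𝟙 Ab.int) : Ab.int ⨿ Ab.int ⟶ Ab.int).hom.hom x := by
  let s : Ab.int ⨿ Ab.int ⟶ Ab.int := ObjectProperty.homMk (AddCommGrpCat.ofHom
    ((coprod.desc (𝟙 Ab.int) 0 : Ab.int ⨿ Ab.int ⟶ Ab.int).hom.hom +
      (coprod.desc 0 (𝟙 Ab.int) : Ab.int ⨿ Ab.int ⟶ Ab.int).hom.hom))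
  have hs : s = coprod.desc (𝟙 Ab.int) (𝟙 Ab.int) := by
    refine coprod.hom_ext (Ab.int_hom_ext ?_) (Ab.int_hom_ext ?_)
    · rw [coprod.inl_desc]
      change (coprod.inl ≫ coprod.desc (𝟙 Ab.int) 0 : Ab.int ⟶ Ab.int).hom.hom (1 : ℤ) +
        (coprod.inl ≫ coprod.desc 0 (𝟙 Ab.int) : Ab.int ⟶ Ab.int).hom.hom (1 : ℤ) = (1 : ℤ)
      rw [coprod.inl_desc, coprod.inl_desc]
      exact add_zero (1 : ℤ)
    · rw [coprod.inr_desc]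
      change (coprod.inr ≫ coprod.desc (𝟙 Ab.int) 0 : Ab.int ⟶ Ab.int).hom.hom (1 : ℤ) +
        (coprod.inr ≫ coprod.desc 0 (𝟙 Ab.int) : Ab.int ⟶ Ab.int).hom.hom (1 : ℤ) = (1 : ℤ)
      rw [coprod.inr_desc, coprod.inr_desc]
      exact zero_add (1 : ℤ)
  rw [← hs]
  rfl

/-- The morphism `ℤ ⟶ ℤ + ℤ` with components `x` and `y`. -/
lemma Ab.exists_components (x y : ℤ) : ∃ g : Ab.int ⟶ Ab.int ⨿ Ab.int,
    g ≫ coprod.desc (𝟙 Ab.int) 0 = Ab.ofInt x ∧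
    g ≫ coprod.desc 0 (𝟙 Ab.int) = Ab.ofInt y ∧
    g ≫ coprod.desc (𝟙 Ab.int) (𝟙 Ab.int) = Ab.ofInt (x + y) := by
  let i : Ab.int ⟶ Ab.int ⨿ Ab.int := coprod.inl
  let j : Ab.int ⟶ Ab.int ⨿ Ab.int := coprod.inr
  have key (p q : Ab.int ⟶ Ab.int) :
      (Ab.ofElt (i.hom.hom x + j.hom.hom y) ≫ coprod.desc p q).hom.hom (1 : ℤ) =
        p.hom.hom x + q.hom.hom y := by
    change (coprod.desc p q).hom.hom ((Ab.ofElt (i.hom.hom x + j.hom.hom y)).hom.hom (1 : ℤ)) = _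
    rw [Ab.ofElt_one, map_add]
    change (i ≫ coprod.desc p q).hom.hom x + (j ≫ coprod.desc p q).hom.hom y = _
    rw [coprod.inl_desc, coprod.inr_desc]
  refine ⟨Ab.ofElt (i.hom.hom x + j.hom.hom y), Ab.int_hom_ext ?_, Ab.int_hom_ext ?_,
    Ab.int_hom_ext ?_⟩
  · exact (key _ _).trans ((add_zero x).trans (Ab.deg_ofInt x).symm)
  · exact (key _ _).trans ((zero_add y).trans (Ab.deg_ofInt y).symm)
  · exact (key _ _).trans (Ab.deg_ofInt (x + y)).symm

/-- Slot-additivity makes the action ℤ-multilinear in the entries, so the integers can be pulled out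
of all n slots at once. -/
lemma MonomialModule.act_eq_smul {k : Type t} [CommRing k] {n : ℕ}
    (M : MonomialModule.{w} k Ab.int n) (a : Fin n → (Ab.int ⟶ Ab.int)) (σ : Equiv.Perm (Fin n))
    (m : M.carrier) :
    M.act a σ m = (∏ i, Ab.deg (a i)) • M.act (fun _ => 𝟙 Ab.int) σ m := by
  let P (z : Fin n → ℤ) : M.carrier := M.act (fun i => Ab.ofInt (z i)) σ m
  have hP (z : Fin n → ℤ) (i : Fin n) (x y : ℤ) : P (Function.update z i (x + y)) =
      P (Function.update z i x) + P (Function.update z i y) := by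
    have key (r : ℤ) : (fun j => Ab.ofInt (Function.update z i r j)) =
        Function.update (fun j => Ab.ofInt (z j)) i (Ab.ofInt r) := by
      funext j
      by_cases hj : j = i
      · subst hj; simp
      · simp [hj]
    obtain ⟨g, h1, h2, h3⟩ := Ab.exists_components x y
    have := M.slotAdditive_act σ m (fun j => Ab.ofInt (z j)) i g
    simp only [h1, h2, h3, ← key] at this
    exact this.symm
  let L : MultilinearMap ℤ (fun _ : Fin n => ℤ) M.carrier := MultilinearMap.mk' P hP
    (fun z i c x => map_zsmul (AddMonoidHom.mk' (fun x => P (Function.update z i x)) (hP z i)) c x)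
  have h := L.map_smul_univ (fun i => Ab.deg (a i)) (fun _ => 1)
  have e1 : (fun i => Ab.ofInt (Ab.deg (a i) • (1 : ℤ))) = a := funext fun i => by
    rw [smul_eq_mul, mul_one]
    exact Ab.ofInt_deg (a i)
  have e2 : (fun _ : Fin n => Ab.ofInt (1 : ℤ)) = fun _ => 𝟙 Ab.int :=
    funext fun i => Ab.ofInt_deg (𝟙 Ab.int)
  change M.act (fun i => Ab.ofInt (Ab.deg (a i) • (1 : ℤ))) σ m =
    (∏ i, Ab.deg (a i)) • M.act (fun _ : Fin n => Ab.ofInt (1 : ℤ)) σ m at h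
  rwa [e1, e2] at h

/-! ### Monomial modules over ℤ are representations of the symmetric group. -/

section

variable (k : Type t) [CommRing k] (n : ℕ)

instance : (monomialForget.{w} k Ab.int n).Faithful where
  map_injective {M N} _ _ h := MonomialModule.hom_ext fun m =>
    congrArg (fun q : (monomialForget.{w} k Ab.int n).obj M ⟶
      (monomialForget.{w} k Ab.int n).obj N => q.hom m) h

instance : (monomialForget.{w} k Ab.int n).Full where
  map_surjective {M N} f := by
    refine ⟨⟨f.hom.toLinearMap, fun a σ m => ?_⟩, rfl⟩
    have h : f.hom.toLinearMap (M.act (fun _ => 𝟙 Ab.int) σ m) =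
      N.act (fun _ => 𝟙 Ab.int) σ (f.hom.toLinearMap m) := Rep.hom_comm_apply f σ m
    rw [M.act_eq_smul, N.act_eq_smul, map_zsmul, h]

instance : (monomialForget.{w} k Ab.int n).EssSurj where
  mem_essImage V := by
    let M : MonomialModule.{w} k Ab.int n :=
      { carrier := ModuleCat.of k V
        -- This formula is forced by `MonomialModule.act_eq_smul`.
        act a σ := (∏ i, Ab.deg (a i)) • V.ρ σ
        act_one m := by simp [Ab.deg_id]
        act_act a b σ τ m := by
          simp only [LinearMap.smul_apply, map_zsmul, Ab.deg_comp, Finset.prod_mul_distrib,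
            map_mul, smul_smul, Module.End.mul_apply]
          rw [Equiv.prod_comp σ fun i => Ab.deg (b i), mul_comm]
        slotAdditive_act σ m a i g := by
          have key (r : Ab.int ⟶ Ab.int) : (∏ j, Ab.deg (Function.update a i r j)) =
              Ab.deg r * ∏ j ∈ Finset.univ \ {i}, Ab.deg (a j) := by
            rw [← Finset.prod_update_of_mem (Finset.mem_univ i)]
            refine Finset.prod_congr rfl fun j _ => ?_
            by_cases hj : j = i
            · subst hj; simp
            · simp [hj]
          simp only [key, LinearMap.smul_apply]
          rw [← add_smul, ← add_mul]
          congr 2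
          exact Ab.coprod_desc_add (g.hom.hom (1 : ℤ)) }
    refine ⟨M, ⟨Rep.mkIso (Representation.Equiv.mk (LinearEquiv.refl k V) fun σ => ?_)⟩⟩
    refine LinearMap.ext fun v => ?_
    change (∏ _ : Fin n, Ab.deg (𝟙 Ab.int)) • V.ρ σ v = V.ρ σ v
    simp [Ab.deg_id]

lemma exists_polQuot_equivalence :
    ∃ e : PolQuot.{w} Ab k n ≌ ModuleCat.{w} (MonoidAlgebra k (Equiv.Perm (Fin n))),
      Nonempty (polProj.{w} Ab k n ⋙ e.functor ≅
        (DegreeLT.{w} Ab k (n + 1)).ι ⋙ crossEffectFunctor.{w} k Ab.int n) := by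
  have := isLocalization_monomialCrossEffect.{w} k Ab.finiteSums_int n
  have : (monomialForget.{w} k Ab.int n).IsEquivalence := {}
  let L := (monomialCrossEffect.{w} k Ab.int n ⋙ monomialForget.{w} k Ab.int n) ⋙
    Rep.equivalenceModuleMonoidAlgebra.functor
  -- A localization functor followed by equivalences is again a localization functor.
  have : L.IsLocalization (polIso.{w} Ab k n) := inferInstance
  exact ⟨Localization.uniq (polProj.{w} Ab k n) L (polIso.{w} Ab k n),
    ⟨Localization.compUniqFunctor _ _ _ ≪≫
      Functor.isoWhiskerRight (monomialCrossEffectForget k Ab.int n) _ ≪≫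
      Functor.associator _ _ _⟩⟩

end

end

end PolyFun

theorem mainTheorem8 (k : Type t) [CommRing k] (n : ℕ) :
    -- the comparison criterion
    (∀ {C : Type u} [Category.{v} C] [HasZeroObject C] [HasZeroMorphisms C]
      [HasFiniteCoproducts C] {D : Type u'} [Category.{v'} D] [HasZeroObject D]
      [HasZeroMorphisms D] [HasFiniteCoproducts D]
      (Φ : C ⥤ D) [PreservesFiniteCoproducts Φ] [Φ.Full] (E : C),
      Function.Bijective (fun f : E ⟶ E => Φ.map f) →
        (∃ φ : PolyFun.Lambda k E ≃ₐ[k] PolyFun.Lambda k (Φ.obj E),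
          ∀ f : E ⟶ E, φ (PolyFun.Lambda.mk k E f) = PolyFun.Lambda.mk k (Φ.obj E) (Φ.map f)) ∧
        PolyFun.InducesPolQuotEquivalence.{max v v' t} k (PolyFun.spanFunctor Φ E) n) ∧
    -- free groups and free abelian groups
    PolyFun.InducesPolQuotEquivalence.{t} k PolyFun.abelianization n ∧
    -- the quotient for free abelian groups, through `F ↦ cr_n(F)(ℤ, …, ℤ)`
    ∃ e : PolyFun.PolQuot.{t} PolyFun.Ab k n ≌
        ModuleCat.{t} (MonoidAlgebra k (Equiv.Perm (Fin n))),
      Nonempty (PolyFun.polProj.{t} PolyFun.Ab k n ⋙ e.functor ≅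
        (PolyFun.DegreeLT.{t} PolyFun.Ab k (n + 1)).ι ⋙
          PolyFun.crossEffectFunctor.{t} k PolyFun.Ab.int n) := by
  refine ⟨fun Φ _ _ E hΦ => ⟨PolyFun.exists_lambda_algEquiv k Φ E hΦ, ?_⟩,
    PolyFun.inducesPolQuotEquivalence_abelianization k n,
    PolyFun.exists_polQuot_equivalence k n⟩
  exact PolyFun.inducesPolQuotEquivalence_spanFunctor.{t} k Φ E hΦ n
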